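/- Let $\varphi_1,\dots,\varphi_M$ be probability densities on $\mathbb R$ and, for $\theta=(\alpha_1,\mu_1,\sigma_1,\dots,\alpha_M,\mu_M,\sigma_M)$ in $$\Theta=\Big\{\theta\in\mathbb R^{3M} : \alpha_m\ge 0,\ \sum_{m=1}^M\alpha_m=1,\ \mu_m\in\mathbb R,\ \sigma_m>0\Big\},$$ let $f(x;\theta)=\sum_{m=1}^M \alpha_m\,\sigma_m^{-1}\varphi_m\big((x-\mu_m)/\sigma_m\big)$. Equip $\Theta$ with the Euclidean distance, and put $\sigma_{(1)}=\min_m\sigma_m$, $\sigma_{(M)}=\max_m\sigma_m$, $\Theta(\theta')=\{\theta\in\Theta: f(\cdot;\theta)=f(\cdot;\theta')\text{ a.e.}\}$, and $\mathrm{dist}(U,V)=\inf_{\theta\in U,\theta'\in V}\mathrm{dist}(\theta,\theta')$ for $U,V\subset\Theta$. Let $\theta_0\in\Theta$, $\Theta_0=\Theta(\theta_0)$, and suppose that: 1. for each $\theta\in\Theta$ and all sufficiently small $\rho>0$, the function $x\mapsto\sup_{\theta'\in\Theta,\ \mathrm{dist}(\theta',\theta)\le\rho}f(x;\theta')$ is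 Lebesgue measurable; 2. for each compact $\Gamma\subset\Theta$ and each $\theta\in\Gamma$ there is a Lebesgue-null set outside which $f(x;\theta^{(j)})\to f(x;\theta)$ for every sequence $\theta^{(j)}\in\Gamma$ with $\theta^{(j)}\to\theta$ (the null set does not depend on the sequence); 3. $\int|\log f(x;\theta_0)|\,f(x;\theta_0)\,dx<\infty$; 4. there are $v_0,v_1>0$ and $\beta>2$ with $\varphi_m(x)\le\min\{v_0,\ v_1|x|^{-\beta}\}$ for all $m$ and $x$; 5. $f(\cdot;\theta_0)$ has exactly $M$ components: it is not a.e. equal to any $f(\cdot;\theta)$, $\theta\in\Theta$, with at most $M-1$ nonzero weights. Let $\bar r_n:(0,1]\to\mathbb R$ $(n\ge1)$ and $r_n(\theta)=\bar r_n(\sigma_{(1)}/\sigma_{(M)})$. Let $0\le\tilde d<1$ and $b_0>0$, put $b_n=b_0\exp(-n^{\tilde d})$, and suppose that: 6. there are constants $\bar R<\infty$, $\bar r>0$, $\delta>0$ such that $0\le\bar r_n(y)\le\min\{\bar R,\ \bar r\,y^{M+\delta}\exp(n^{\tilde d})\}$ for all $n\ge1$ and $y\in(0,1]$; 7. there are $r_{\Theta_0}>0$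 and $N$ such that $r_n(\theta)\ge r_{\Theta_0}$ for all $\theta\in\Theta_0$ and $n\ge N$; 8. there are $d\in(\tilde d,1)$, $c_0>0$, $\Delta>0$ such that, with $c_n=c_0\exp(-n^{d})$, for all $n\ge1$ and all $\theta\in\Theta$ with $\sigma_{(1)}<c_n$, $$r_n(\theta)>(\sigma_{(1)})^{M}\ \Longrightarrow\ \sigma_{(M)}<\frac{(\sigma_{(1)})^{\Delta}}{b_n}.$$ Let $X_1,X_2,\dots$ be i.i.d. with density $f(\cdot;\theta_0)$, and let $g_n(\theta)=r_n(\theta)\prod_{i=1}^n f(X_i;\theta)$ be the penalized likelihood. Then every penalized maximum likelihood estimator is strongly consistent. That is, if $\hat\theta_n$ is a sequence of random elements such that, almost surely, for all sufficiently large $n$, $\hat\theta_n$ maximizes $g_n$ over $\Theta$ (or, more generally, $\hat\theta_n\in\Theta$ and $g_n(\hat\theta_n)\ge c\,g_n(\theta)$ for all $\theta\in\Theta$, where $c\in(0,1]$ is a fixed constant), then $$\mathrm{Prob}\Big(\lim_{n\to\infty}\mathrm{dist}\big(\Theta(\hat\theta_n),\Theta_0\big)=0\Big)=1.$$ -/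

import Mathlib

open MeasureTheory ProbabilityTheory Filter Topology

noncomputable section

namespace LocScaleMixture

/-- The ambient Euclidean space of the parameter vectors
`θ = (α₁, μ₁, σ₁, …, α_M, μ_M, σ_M)`; its metric is the distance between parameters. -/
abbrev Vec (M : ℕ) : Type := EuclideanSpace ℝ (Fin 3 × Fin M)

/-- The mixing weight `α_m`. -/
def weight {M : ℕ} (θ : Vec M) (m : Fin M) : ℝ := θ (0, m)

/-- The location parameter `μ_m`. -/
def loc {M : ℕ} (θ : Vec M) (m : Fin M) : ℝ := θ (1, m)

/-- The scale parameter `σ_m`. -/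
def scale {M : ℕ} (θ : Vec M) (m : Fin M) : ℝ := θ (2, m)

/-- The parameter space `Θ`. -/
def paramSpace (M : ℕ) : Set (Vec M) :=
  {θ | (∀ m, 0 ≤ weight θ m) ∧ ∑ m, weight θ m = 1 ∧ ∀ m, 0 < scale θ m}

/-- The smallest scale parameter `σ₍₁₎`. -/
def minScale {M : ℕ} (θ : Vec M) : ℝ := ⨅ m, scale θ m

/-- The largest scale parameter `σ₍M₎`. -/
def maxScale {M : ℕ} (θ : Vec M) : ℝ := ⨆ m, scale θ m

/-- A probability density on the real line. -/
structure IsProbDensity (φ : ℝ → ℝ) : Prop where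
  measurable : Measurable φ
  nonneg : ∀ x, 0 ≤ φ x
  integral_eq_one : ∫ x, φ x = 1

/-- The mixture density `f(x; θ) = ∑ α_m σ_m⁻¹ φ_m((x - μ_m) / σ_m)`, where `φ_m` is the
standard (location 0, scale 1) density of the `m`-th component. -/
def mixDensity {M : ℕ} (φ : Fin M → ℝ → ℝ) (θ : Vec M) (x : ℝ) : ℝ :=
  ∑ m, weight θ m * (1 / scale θ m * φ m ((x - loc θ m) / scale θ m))

/-- The class `𝒢_K` of mixture densities (identified when equal almost everywhere) with no more
than `K` components. -/
def mixtureClass {M : ℕ} (φ : Fin M → ℝ → ℝ) (K : ℕ) : Set (ℝ → ℝ) :=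
  {g | ∃ θ ∈ paramSpace M, Set.ncard {m | weight θ m ≠ 0} ≤ K ∧ g =ᵐ[volume] mixDensity φ θ}

/-- `Θ(θ')`: the parameters that give the same density as `θ'`, almost everywhere. -/
def sameDensity {M : ℕ} (φ : Fin M → ℝ → ℝ) (θ' : Vec M) : Set (Vec M) :=
  {θ | θ ∈ paramSpace M ∧ mixDensity φ θ =ᵐ[volume] mixDensity φ θ'}

/-- The distance `inf {dist θ θ' | θ ∈ U, θ' ∈ V}` between two sets of parameters. -/
def setDist {M : ℕ} (U V : Set (Vec M)) : ℝ := sInf (Set.image2 dist U V)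

/-- `f(x; θ, ρ)`: the supremum of `f(x; θ')` over the parameters `θ'` within distance `ρ`
of `θ`. -/
def supDensity {M : ℕ} (φ : Fin M → ℝ → ℝ) (θ : Vec M) (ρ : ℝ) (x : ℝ) : ENNReal :=
  ⨆ θ' ∈ paramSpace M ∩ Metric.closedBall θ ρ, ENNReal.ofReal (mixDensity φ θ' x)

/-- For every parameter `θ` and every sufficiently small `ρ > 0`, the function `f(·; θ, ρ)` is
(Lebesgue) measurable. -/
def SupDensityMeasurable {M : ℕ} (φ : Fin M → ℝ → ℝ) : Prop :=
  ∀ θ ∈ paramSpace M, ∀ᶠ ρ in 𝓝[>] (0 : ℝ), AEMeasurable (supDensity φ θ ρ) volume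

/-- On every compact set of parameters, the density depends continuously on the parameter, outside
a null set of `x` that does not depend on the approximating sequence. -/
def AEContinuousInParam {M : ℕ} (φ : Fin M → ℝ → ℝ) : Prop :=
  ∀ Γ : Set (Vec M), Γ ⊆ paramSpace M → IsCompact Γ → ∀ θ ∈ Γ,
    ∀ᵐ x ∂(volume : Measure ℝ), ∀ u : ℕ → Vec M, (∀ j, u j ∈ Γ) → Tendsto u atTop (𝓝 θ) →
      Tendsto (fun j => mixDensity φ (u j) x) atTop (𝓝 (mixDensity φ θ x))

/-- `∫ |log f(x; θ₀)| f(x; θ₀) dx < ∞`. -/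
def LogIntegrable {M : ℕ} (φ : Fin M → ℝ → ℝ) (θ₀ : Vec M) : Prop :=
  Integrable (fun x => |Real.log (mixDensity φ θ₀ x)| * mixDensity φ θ₀ x) volume

/-- The standard component densities are at most `min {v₀, v₁ |x| ^ (-β)}` for some `β > 2`;
at `x = 0` the second bound is infinite. -/
def TailBound {M : ℕ} (φ : Fin M → ℝ → ℝ) : Prop :=
  ∃ v₀ v₁ β : ℝ, 0 < v₀ ∧ 0 < v₁ ∧ 2 < β ∧
    ∀ m x, φ m x ≤ v₀ ∧ (x ≠ 0 → φ m x ≤ v₁ * |x| ^ (-β))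

/-- The reward `r_n(θ) = r̄_n(σ₍₁₎ / σ₍M₎)`. -/
def reward {M : ℕ} (rbar : ℕ → ℝ → ℝ) (n : ℕ) (θ : Vec M) : ℝ :=
  rbar n (minScale θ / maxScale θ)

/-- The penalized likelihood `g_n(θ; x) = (∏ f(x_i; θ)) r_n(θ)` of the first `n` terms of the
data sequence `x`. -/
def penLikelihood {M : ℕ} (φ : Fin M → ℝ → ℝ) (rbar : ℕ → ℝ → ℝ) (n : ℕ) (x : ℕ → ℝ)
    (θ : Vec M) : ℝ :=
  (∏ i ∈ Finset.range n, mixDensity φ θ (x i)) * reward rbar n θ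

/-- `0 ≤ r̄_n(y) ≤ min {R̄, r̄ y ^ (M + δ) exp (n ^ d̃)}` for all `n ≥ 1` and `y ∈ (0, 1]`. -/
def RewardBound (M : ℕ) (rbar : ℕ → ℝ → ℝ) (dt : ℝ) : Prop :=
  ∃ R r δ : ℝ, 0 < r ∧ 0 < δ ∧ ∀ n : ℕ, 1 ≤ n → ∀ y ∈ Set.Ioc (0 : ℝ) 1,
    0 ≤ rbar n y ∧
      rbar n y ≤ min R (r * y ^ ((M : ℝ) + δ) * Real.exp ((n : ℝ) ^ dt))

/-- The reward is bounded below on `Θ₀`, by a positive constant, for all large `n`. -/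
def RewardLowerBound {M : ℕ} (φ : Fin M → ℝ → ℝ) (θ₀ : Vec M) (rbar : ℕ → ℝ → ℝ) : Prop :=
  ∃ r : ℝ, 0 < r ∧ ∃ N : ℕ, ∀ n ≥ N, ∀ θ ∈ sameDensity φ θ₀, r ≤ reward rbar n θ

/-- With `b_n = b₀ exp (-n ^ d̃)` and `c_n = c₀ exp (-n ^ d)`, for some `d ∈ (d̃, 1)`, `c₀ > 0` and
`Δ > 0`: if `σ₍₁₎ < c_n` and `r_n(θ) > σ₍₁₎ ^ M`, then `σ₍M₎ < σ₍₁₎ ^ Δ / b_n`. -/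
def ScalesEquallySmall (M : ℕ) (rbar : ℕ → ℝ → ℝ) (dt b₀ : ℝ) : Prop :=
  ∃ d c₀ Δ : ℝ, dt < d ∧ d < 1 ∧ 0 < c₀ ∧ 0 < Δ ∧
    ∀ n : ℕ, 1 ≤ n → ∀ θ ∈ paramSpace M,
      minScale θ < c₀ * Real.exp (-(n : ℝ) ^ d) →
      minScale θ ^ M < reward rbar n θ →
      maxScale θ < minScale θ ^ Δ / (b₀ * Real.exp (-(n : ℝ) ^ dt))

/-- `θ` attains the supremum of the penalized likelihood over `Θ` up to the factor `c`; for `c = 1`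
it is an exact maximizer. -/
def IsPenalizedMLE {M : ℕ} (φ : Fin M → ℝ → ℝ) (rbar : ℕ → ℝ → ℝ) (c : ℝ) (n : ℕ) (x : ℕ → ℝ)
    (θ : Vec M) : Prop :=
  θ ∈ paramSpace M ∧
    ∀ θ' ∈ paramSpace M, c * penLikelihood φ rbar n x θ' ≤ penLikelihood φ rbar n x θ

/-- `X₀, X₁, …` are independent with common density `f`. -/
structure IsSample {Ω : Type*} [MeasurableSpace Ω] (P : Measure Ω) (X : ℕ → Ω → ℝ)
    (f : ℝ → ℝ) : Prop where
  measurable : ∀ i, Measurable (X i)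
  indep : iIndepFun X P
  law : ∀ i, P.map (X i) = volume.withDensity (fun x => ENNReal.ofReal (f x))

/-- Strong consistency: almost surely, the distance between `Θ(θ̂_n)` and `Θ(θ₀)` tends to 0. -/
def StronglyConsistent {M : ℕ} (φ : Fin M → ℝ → ℝ) (θ₀ : Vec M) {Ω : Type*} [MeasurableSpace Ω]
    (P : Measure Ω) (est : ℕ → Ω → Vec M) : Prop :=
  ∀ᵐ ω ∂P, Tendsto (fun n => setDist (sameDensity φ (est n ω)) (sameDensity φ θ₀)) atTop (𝓝 0)

end LocScaleMixture

end

open LocScaleMixture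

/-!
Strong consistency of the penalized maximum likelihood estimator, by Hellinger affinities.

For a nonnegative function `u`, Markov's inequality applied to the square root of the likelihood
ratio bounds the probability that `K ∏ u(X_i)` exceeds `∏ f(X_i; θ₀)` by `√K (∫ √u √f(·; θ₀)) ^ n`
(`IsSample.measure_prod_le`). An affinity `∫ √u √f(·; θ₀)` less than `1` thus rules out every
parameter whose penalized likelihood is at most `K ∏ u(X_i)`, and even exponentially many such `u`
can be handled at once by Borel–Cantelli (`IsSample.ae_eventually_prod_lt`). The tail exponent
`β > 2` makes `√f(·; θ₀)` integrable. So functions that are uniformly small have small affinity, and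
`∫ √(σ⁻¹ φ(x / σ)) dx` is of order `√σ`, so components of small scale have small affinity too.

*Compactness.* If the parameters at distance at least `ε` from `Θ₀` were not covered by finitely many
sets that are ruled out, some ultrafilter on them would contain no such set. Along an ultrafilter the
weights converge, and each component converges, or degenerates to scale `0`, or flattens out or moves
to infinity (`component_trichotomy`). If the components that converge add up to a density different
from `f(·; θ₀)`, then its affinity is less than `1`. The local supremum of the density, together with
bounds for the components that flatten out or move away, then gives a function `g` of affinity less
than `1` which dominates all the densities of a set in the ultrafilter, up to components of
arbitrarily small scale (`ultrafilter_dichotomy`). Otherwise all `M` components converge, because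
`f(·; θ₀)` is no mixture of fewer, and the limit lies in `Θ₀`, which is impossible.

*Components of small scale.* For scales at least `exp (-ε n)` and locations in the range of the data
the components are dominated by `exp (O(ε n))` grid brackets (`gridBracket`). A component of smaller
scale comes close to at most one observation, as the observations are exponentially separated. If
the reward is at most `σ₍₁₎ ^ M`, it compensates for the at most `M` factors of order `1 / σ₍₁₎`
that arise in this way. If it is larger, then all the scales are exponentially small, and all but
`M` factors of the likelihood are exponentially small (`penLikelihood_le_of_scales_tiny`).
`exists_bracket_penLikelihood_le` combines these bounds and `exists_ae_eventually_penLikelihood_lt`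
draws the probabilistic conclusion.
-/

namespace LocScaleMixture

/-! ### Pointwise bounds on the components -/

/-- The density of the `m`-th component of the mixture with parameter `θ`. -/
noncomputable def component {M : ℕ} (φ : Fin M → ℝ → ℝ) (θ : Vec M) (m : Fin M) (x : ℝ) : ℝ :=
  1 / scale θ m * φ m ((x - loc θ m) / scale θ m)

/-- A polynomial envelope of the standard component densities, without the singularity at `0` of
the bound in `TailBound`. -/
def HasEnvelope {M : ℕ} (φ : Fin M → ℝ → ℝ) (C β : ℝ) : Prop :=
  ∀ m z, φ m z ≤ C * (1 + |z|) ^ (-β)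

lemma TailBound.exists_envelope {M : ℕ} {φ : Fin M → ℝ → ℝ} (h : TailBound φ) :
    ∃ C β : ℝ, 1 ≤ C ∧ 2 < β ∧ HasEnvelope φ C β := by
  obtain ⟨v₀, v₁, β, h0, h1, hβ, hb⟩ := h
  have h2 : (0:ℝ) < 2 ^ β := by positivity
  refine ⟨max 1 (max v₀ v₁ * 2 ^ β), β, le_max_left _ _, hβ, fun m z => ?_⟩
  have hz : 0 < 1 + |z| := by positivity
  have key : φ m z ≤ (max v₀ v₁ * 2 ^ β) * (1 + |z|) ^ (-β) := by
    rw [mul_assoc, Real.rpow_neg hz.le, ← Real.inv_rpow hz.le,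
      ← Real.mul_rpow (by norm_num) (by positivity)]
    rcases le_total |z| 1 with hz1 | hz1
    · have : 1 ≤ (2 * (1 + |z|)⁻¹) ^ β := by
        apply Real.one_le_rpow _ (by linarith)
        rw [← div_eq_mul_inv, le_div_iff₀ hz]; linarith
      calc φ m z ≤ v₀ := (hb m z).1
        _ ≤ max v₀ v₁ := le_max_left _ _
        _ ≤ _ := le_mul_of_one_le_right (by positivity) this
    · have hz0 : z ≠ 0 := by rintro rfl; simp at hz1; linarith
      calc φ m z ≤ v₁ * |z| ^ (-β) := (hb m z).2 hz0
        _ ≤ max v₀ v₁ * (2 * (1 + |z|)⁻¹) ^ β := by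
          rw [Real.rpow_neg (abs_nonneg _), ← Real.inv_rpow (abs_nonneg _)]
          gcongr
          · exact le_max_right _ _
          · rw [← div_eq_mul_inv, le_div_iff₀ hz, inv_mul_le_iff₀ (by linarith)]; linarith
  exact key.trans (mul_le_mul_of_nonneg_right (le_max_right _ _) (by positivity))

section Components

variable {M : ℕ} {φ : Fin M → ℝ → ℝ} {C β : ℝ} {θ : Vec M} {m : Fin M}

lemma mixDensity_eq_sum_component (φ : Fin M → ℝ → ℝ) (θ : Vec M) (x : ℝ) :
    mixDensity φ θ x = ∑ m, weight θ m * component φ θ m x := rfl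

lemma component_nonneg (hφ : ∀ m, IsProbDensity (φ m)) (hs : 0 < scale θ m) (x : ℝ) :
    0 ≤ component φ θ m x :=
  mul_nonneg (by positivity) ((hφ m).nonneg _)

lemma mixDensity_nonneg (hφ : ∀ m, IsProbDensity (φ m)) (hθ : θ ∈ paramSpace M) (x : ℝ) :
    0 ≤ mixDensity φ θ x :=
  Finset.sum_nonneg fun m _ => mul_nonneg (hθ.1 m) (component_nonneg hφ (hθ.2.2 m) x)

lemma weight_le_one (hθ : θ ∈ paramSpace M) (m : Fin M) : weight θ m ≤ 1 :=
  hθ.2.1 ▸ Finset.single_le_sum (fun i _ => hθ.1 i) (Finset.mem_univ m)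

lemma weight_mul_component_le (hφ : ∀ m, IsProbDensity (φ m)) (hθ : θ ∈ paramSpace M) (m : Fin M)
    (x : ℝ) : weight θ m * component φ θ m x ≤ component φ θ m x :=
  mul_le_of_le_one_left (component_nonneg hφ (hθ.2.2 m) x) (weight_le_one hθ m)

lemma measurable_component (hφ : ∀ m, IsProbDensity (φ m)) (θ : Vec M) (m : Fin M) :
    Measurable (component φ θ m) := by
  have := (hφ m).measurable
  unfold component
  fun_prop

lemma measurable_mixDensity (hφ : ∀ m, IsProbDensity (φ m)) (θ : Vec M) :
    Measurable (mixDensity φ θ) :=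
  Finset.measurable_sum _ fun m _ => (measurable_component hφ θ m).const_mul _

/-- The envelope transported to a component of scale `σ` whose location is `y` away. -/
lemma component_le_envelope (henv : HasEnvelope φ C β) (hs : 0 < scale θ m) (x : ℝ) :
    component φ θ m x ≤ C / scale θ m * (1 + |x - loc θ m| / scale θ m) ^ (-β) := by
  have := henv m ((x - loc θ m) / scale θ m)
  rw [abs_div, abs_of_pos hs] at this
  calc component φ θ m x ≤ 1 / scale θ m * (C * (1 + |x - loc θ m| / scale θ m) ^ (-β)) := by
        unfold component; gcongr
    _ = _ := by ring

lemma component_le_div_scale (henv : HasEnvelope φ C β) (hC : 0 ≤ C) (hβ : 0 ≤ β)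
    (hs : 0 < scale θ m) (x : ℝ) : component φ θ m x ≤ C / scale θ m := by
  refine (component_le_envelope henv hs x).trans (mul_le_of_le_one_right (by positivity) ?_)
  exact Real.rpow_le_one_of_one_le_of_nonpos (by simp; positivity) (by linarith)

/-- Away from its location, a component of small scale is small. -/
lemma component_le_of_far (henv : HasEnvelope φ C β) (hC : 0 ≤ C) (hβ : 2 ≤ β)
    (hs : 0 < scale θ m) {x r : ℝ} (hr : 0 < r) (hx : r ≤ |x - loc θ m|) :
    component φ θ m x ≤ C * scale θ m / r ^ 2 := by
  refine (component_le_envelope henv hs x).trans ?_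
  have h1 : (1 + |x - loc θ m| / scale θ m) ^ (-β) ≤ (r / scale θ m) ^ (-2 : ℝ) := by
    calc (1 + |x - loc θ m| / scale θ m) ^ (-β)
        ≤ (1 + |x - loc θ m| / scale θ m) ^ (-2 : ℝ) :=
          Real.rpow_le_rpow_of_exponent_le (by simp; positivity) (by linarith)
      _ ≤ _ := by
          apply Real.rpow_le_rpow_of_nonpos (by positivity) _ (by norm_num)
          calc r / scale θ m ≤ |x - loc θ m| / scale θ m := by gcongr
            _ ≤ _ := by linarith
  calc _ ≤ C / scale θ m * (r / scale θ m) ^ (-2 : ℝ) := by gcongr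
    _ = _ := by
      rw [Real.rpow_neg (by positivity)]
      norm_cast
      field_simp

lemma minScale_le (θ : Vec M) (m : Fin M) : minScale θ ≤ scale θ m :=
  ciInf_le (Set.finite_range _).bddBelow m

lemma le_maxScale (θ : Vec M) (m : Fin M) : scale θ m ≤ maxScale θ :=
  le_ciSup (Set.finite_range _).bddAbove m

lemma nonempty_of_mem_paramSpace (hθ : θ ∈ paramSpace M) : Nonempty (Fin M) := by
  by_contra h
  rw [not_nonempty_iff] at h
  simpa using hθ.2.1

lemma minScale_pos (hθ : θ ∈ paramSpace M) : 0 < minScale θ := by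
  have := nonempty_of_mem_paramSpace hθ
  obtain ⟨m, hm⟩ := exists_eq_ciInf_of_finite (f := fun m => scale θ m)
  unfold minScale
  rw [← hm]; exact hθ.2.2 m

lemma minScale_le_maxScale (hθ : θ ∈ paramSpace M) : minScale θ ≤ maxScale θ := by
  obtain ⟨m⟩ := nonempty_of_mem_paramSpace hθ
  exact (minScale_le θ m).trans (le_maxScale θ m)

lemma scaleRatio_mem (hθ : θ ∈ paramSpace M) :
    minScale θ / maxScale θ ∈ Set.Ioc (0 : ℝ) 1 :=
  ⟨div_pos (minScale_pos hθ) ((minScale_pos hθ).trans_le (minScale_le_maxScale hθ)),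
    div_le_one_of_le₀ (minScale_le_maxScale hθ)
      ((minScale_pos hθ).le.trans (minScale_le_maxScale hθ))⟩

lemma mixDensity_le_of_component_le (hθ : θ ∈ paramSpace M) {x B : ℝ}
    (h : ∀ m, component φ θ m x ≤ B) : mixDensity φ θ x ≤ B := by
  calc mixDensity φ θ x ≤ ∑ m, weight θ m * B :=
        Finset.sum_le_sum fun m _ => mul_le_mul_of_nonneg_left (h m) (hθ.1 m)
    _ = B := by rw [← Finset.sum_mul, hθ.2.1, one_mul]

lemma mixDensity_le_div_minScale (henv : HasEnvelope φ C β) (hC : 0 ≤ C) (hβ : 0 ≤ β)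
    (hθ : θ ∈ paramSpace M) (x : ℝ) : mixDensity φ θ x ≤ C / minScale θ :=
  mixDensity_le_of_component_le hθ fun m =>
    (component_le_div_scale henv hC hβ (hθ.2.2 m) x).trans
      (by gcongr; exacts [minScale_pos hθ, minScale_le θ m])

/-- A mixture density decays like the envelope. -/
lemma exists_mixDensity_le (henv : HasEnvelope φ C β) (hC : 0 ≤ C) (hβ : 0 ≤ β)
    (hθ : θ ∈ paramSpace M) : ∃ F : ℝ, 0 ≤ F ∧ ∀ x, mixDensity φ θ x ≤ F * (1 + |x|) ^ (-β) := by
  have hm : ∀ m, ∃ D : ℝ, 0 ≤ D ∧ ∀ x, component φ θ m x ≤ D * (1 + |x|) ^ (-β) := by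
    intro m
    have hs := hθ.2.2 m
    set A := 1 + |loc θ m| + scale θ m with hA
    have hA0 : 0 < A := by positivity
    refine ⟨C / scale θ m * A ^ β, by positivity, fun x => ?_⟩
    refine (component_le_envelope henv hs x).trans ?_
    rw [mul_assoc]
    gcongr
    have h1 : 1 + |x| ≤ A * (1 + |x - loc θ m| / scale θ m) := by
      have e : A * (1 + |x - loc θ m| / scale θ m) =
          A + (1 + |loc θ m|) / scale θ m * |x - loc θ m| + |x - loc θ m| := by
        rw [hA]; field_simp; ring
      have e2 : 0 ≤ (1 + |loc θ m|) / scale θ m * |x - loc θ m| := by positivity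
      have e3 : |x| ≤ |x - loc θ m| + |loc θ m| := by
        simpa using abs_add_le (x - loc θ m) (loc θ m)
      rw [e, hA]; linarith
    have hp : 0 < 1 + |x - loc θ m| / scale θ m := by positivity
    have hp2 : 0 < 1 + |x| := by positivity
    rw [Real.rpow_neg hp.le, Real.rpow_neg hp2.le, ← div_eq_mul_inv, le_div_iff₀ (by positivity),
      inv_mul_le_iff₀ (by positivity), ← Real.mul_rpow hp.le hA0.le, mul_comm]
    gcongr
  choose D hD0 hD using hm
  refine ⟨∑ m, D m, Finset.sum_nonneg fun m _ => hD0 m, fun x => ?_⟩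
  refine mixDensity_le_of_component_le hθ fun m => (hD m x).trans ?_
  gcongr
  exact Finset.single_le_sum (fun i _ => hD0 i) (Finset.mem_univ m)

end Components

/-! ### Hellinger affinity -/

/-- The Hellinger affinity `∫ √u √f` of a density `f` and a nonnegative function `u`, which need
not be a density. -/
noncomputable def affinity (f u : ℝ → ENNReal) : ENNReal :=
  ∫⁻ x, u x ^ (1 / 2 : ℝ) * f x ^ (1 / 2 : ℝ)

section Affinity

variable {f u v : ℝ → ENNReal}

lemma affinity_mono (h : ∀ x, u x ≤ v x) : affinity f u ≤ affinity f v :=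
  lintegral_mono fun x => by
    have := h x
    dsimp only
    gcongr

lemma affinity_congr_ae (h : u =ᵐ[volume] v) : affinity f u = affinity f v :=
  lintegral_congr_ae (h.mono fun x hx => by simp only [hx])

lemma affinity_add_le (hf : Measurable f) (hu : AEMeasurable u) :
    affinity f (u + v) ≤ affinity f u + affinity f v := by
  unfold affinity
  rw [← lintegral_add_left' (by fun_prop)]
  refine lintegral_mono fun x => ?_
  rw [← add_mul]
  gcongr
  exact ENNReal.rpow_add_le_add_rpow _ _ (by norm_num) (by norm_num)

lemma affinity_sum_le (hf : Measurable f) {ι : Type*} (s : Finset ι) (u : ι → ℝ → ENNReal)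
    (hu : ∀ i ∈ s, AEMeasurable (u i)) :
    affinity f (∑ i ∈ s, u i) ≤ ∑ i ∈ s, affinity f (u i) := by
  classical
  induction s using Finset.induction_on with
  | empty => simp [affinity]
  | insert a s ha ih =>
    rw [Finset.sum_insert ha, Finset.sum_insert ha]
    refine (affinity_add_le hf (hu a (by simp))).trans ?_
    gcongr
    exact ih fun i hi => hu i (Finset.mem_insert_of_mem hi)

lemma affinity_const (hf : Measurable f) (a : ENNReal) :
    affinity f (fun _ => a) = a ^ (1 / 2 : ℝ) * affinity f (fun _ => 1) := by
  unfold affinity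
  rw [lintegral_const_mul _ (by fun_prop)]
  simp

lemma integrable_one_add_abs_rpow {p : ℝ} (hp : 1 < p) :
    Integrable (fun x : ℝ => (1 + |x|) ^ (-p)) := by
  simpa using integrable_one_add_norm (E := ℝ) (μ := volume) (r := p) (by simpa using hp)

lemma ofReal_rpow_half_mul {a b β : ℝ} (ha : 0 ≤ a) (hb : 0 < b) :
    ENNReal.ofReal (a * b ^ (-β)) ^ (1 / 2 : ℝ) = ENNReal.ofReal (√a * b ^ (-(β / 2))) := by
  rw [ENNReal.ofReal_rpow_of_nonneg (by positivity) (by norm_num), Real.mul_rpow ha (by positivity),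
    ← Real.sqrt_eq_rpow, ← Real.rpow_mul hb.le]
  congr 3; ring

/-- The square root of a density with tails of order `|x| ^ (-β)` is integrable because `β / 2 > 1`. -/
lemma affinity_one_ne_top (F β : ℝ) (hF : 0 ≤ F) (hβ : 2 < β)
    (hfF : ∀ x, f x ≤ ENNReal.ofReal (F * (1 + |x|) ^ (-β))) :
    affinity f (fun _ => 1) ≠ ⊤ := by
  have hi := (integrable_one_add_abs_rpow (p := β / 2) (by linarith)).const_mul (√F)
  refine ne_top_of_le_ne_top hi.lintegral_lt_top.ne ?_
  refine lintegral_mono fun x => ?_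
  rw [← ofReal_rpow_half_mul hF (by positivity), ENNReal.one_rpow, one_mul]
  have := hfF x
  gcongr

/-- Two densities (the first possibly defective) with affinity at least `1` coincide. -/
lemma ae_eq_of_one_le_affinity {g h : ℝ → ℝ} (hg : Integrable g) (hh : Integrable h)
    (hg0 : ∀ x, 0 ≤ g x) (hh0 : ∀ x, 0 ≤ h x) (hg1 : ∫ x, g x ≤ 1) (hh1 : ∫ x, h x = 1)
    (haff : 1 ≤ affinity (fun x => ENNReal.ofReal (h x)) (fun x => ENNReal.ofReal (g x))) :
    g =ᵐ[volume] h := by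
  have hle : ∀ x, √(g x) * √(h x) ≤ (g x + h x) / 2 := fun x => by
    nlinarith [sq_nonneg (√(g x) - √(h x)), Real.sq_sqrt (hg0 x), Real.sq_sqrt (hh0 x)]
  have hsum : Integrable (fun x => (g x + h x) / 2) := (hg.add hh).div_const 2
  have hprod : Integrable (fun x => √(g x) * √(h x)) := by
    refine hsum.mono' ?_ (ae_of_all _ fun x => ?_)
    · exact (Real.continuous_sqrt.comp_aestronglyMeasurable hg.1).mul
        (Real.continuous_sqrt.comp_aestronglyMeasurable hh.1)
    · rw [Real.norm_of_nonneg (by positivity)]; exact hle x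
  have hint : 1 ≤ ∫ x, √(g x) * √(h x) := by
    have e : affinity (fun x => ENNReal.ofReal (h x)) (fun x => ENNReal.ofReal (g x)) =
        ENNReal.ofReal (∫ x, √(g x) * √(h x)) := by
      rw [ofReal_integral_eq_lintegral_ofReal hprod (ae_of_all _ fun x => by positivity)]
      refine lintegral_congr fun x => ?_
      rw [ENNReal.ofReal_rpow_of_nonneg (hg0 x) (by norm_num),
        ENNReal.ofReal_rpow_of_nonneg (hh0 x) (by norm_num), ← Real.sqrt_eq_rpow,
        ← Real.sqrt_eq_rpow, ENNReal.ofReal_mul (by positivity)]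
    rw [e] at haff
    simpa using haff
  have hd : Integrable (fun x => (g x + h x) / 2 - √(g x) * √(h x)) := hsum.sub hprod
  have hd0 : ∀ x, 0 ≤ (g x + h x) / 2 - √(g x) * √(h x) := fun x => sub_nonneg.2 (hle x)
  have hz : ∫ x, ((g x + h x) / 2 - √(g x) * √(h x)) = 0 := by
    refine le_antisymm ?_ (integral_nonneg hd0)
    rw [integral_sub hsum hprod, integral_div, integral_add hg hh]
    linarith
  rw [integral_eq_zero_iff_of_nonneg hd0 hd] at hz
  filter_upwards [hz] with x hx
  have h0 : (√(g x) - √(h x)) ^ 2 = 0 := by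
    have := Real.sq_sqrt (hg0 x)
    have := Real.sq_sqrt (hh0 x)
    simp only [Pi.zero_apply] at hx
    nlinarith
  have h1 : √(g x) = √(h x) := by nlinarith [pow_eq_zero_iff (two_ne_zero) |>.1 h0]
  exact (Real.sqrt_inj (hg0 x) (hh0 x)).1 h1

/-- Every a.e. measurable function has a measurable majorant in its a.e. class. -/
lemma exists_measurable_ge_ae_eq (hu : AEMeasurable u) :
    ∃ v, Measurable v ∧ (∀ x, u x ≤ v x) ∧ v =ᵐ[volume] u := by
  classical
  have hnull : volume {x | ¬ u x = hu.mk u x} = 0 := hu.ae_eq_mk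
  set N := toMeasurable volume {x | ¬ u x = hu.mk u x} with hN
  have hNm : MeasurableSet N := measurableSet_toMeasurable _ _
  have hN0 : volume N = 0 := by rw [hN, measure_toMeasurable, hnull]
  have hNsub : ∀ x, x ∉ N → u x = hu.mk u x := fun x hx => by
    by_contra h
    exact hx (subset_toMeasurable _ _ h)
  refine ⟨N.piecewise (fun _ => ⊤) (hu.mk u),
    Measurable.piecewise hNm measurable_const hu.measurable_mk, fun x => ?_, ?_⟩
  · by_cases hx : x ∈ N
    · simp [hx]
    · simp [hx, hNsub x hx]
  · have : ∀ᵐ x, x ∉ N := measure_eq_zero_iff_ae_notMem.1 hN0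
    filter_upwards [this] with x hx
    simp [hx, hNsub x hx]

end Affinity

/-! ### Brackets for components of small scale -/

/-- An upper bound for all the components with scale in `(1 / (k + 1), 1 / k]` and location in
`[l / (k + 1), (l + 1) / (k + 1))`. -/
noncomputable def gridBracket (C β : ℝ) (k : ℕ) (l : ℤ) (x : ℝ) : ENNReal :=
  ENNReal.ofReal (C * 2 ^ β * (k + 1) * (1 + |x * (k + 1) - l|) ^ (-β))

lemma measurable_gridBracket (C β : ℝ) (k : ℕ) (l : ℤ) : Measurable (gridBracket C β k l) := by
  unfold gridBracket
  fun_prop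

lemma component_le_gridBracket {M : ℕ} {φ : Fin M → ℝ → ℝ} {C β : ℝ} {θ : Vec M} {m : Fin M}
    (henv : HasEnvelope φ C β) (hC : 0 ≤ C) (hβ : 0 ≤ β)
    (hs : 0 < scale θ m) (hs1 : scale θ m ≤ 1) (x : ℝ) :
    ENNReal.ofReal (component φ θ m x) ≤
      gridBracket C β ⌊1 / scale θ m⌋₊ ⌊loc θ m * (⌊1 / scale θ m⌋₊ + 1)⌋ x := by
  set k := ⌊1 / scale θ m⌋₊ with hk
  set l := ⌊loc θ m * (k + 1)⌋ with hl
  apply ENNReal.ofReal_le_ofReal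
  refine (component_le_envelope henv hs x).trans ?_
  have hk1 : 1 / scale θ m < k + 1 := Nat.lt_floor_add_one _
  have hk2 : (k : ℝ) ≤ 1 / scale θ m := Nat.floor_le (by positivity)
  have hk3 : (k : ℝ) + 1 ≤ 2 / scale θ m := by
    have : 1 ≤ 1 / scale θ m := by rwa [le_div_iff₀ hs, one_mul]
    calc (k : ℝ) + 1 ≤ 1 / scale θ m + 1 / scale θ m := by linarith
      _ = _ := by ring
  have hl1 : (l : ℝ) ≤ loc θ m * (k + 1) := Int.floor_le _
  have hl2 : loc θ m * (k + 1) < l + 1 := Int.lt_floor_add_one _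
  have hw : |x * (k + 1) - l| ≤ 2 * (|x - loc θ m| / scale θ m) + 1 := by
    calc |x * (k + 1) - l| = |(x - loc θ m) * (k + 1) + (loc θ m * (k + 1) - l)| := by ring_nf
      _ ≤ |(x - loc θ m) * (k + 1)| + |loc θ m * (k + 1) - l| := abs_add_le _ _
      _ ≤ |x - loc θ m| * (2 / scale θ m) + 1 := by
        gcongr
        · rw [abs_mul]; gcongr; rw [abs_of_nonneg (by positivity)]; exact hk3
        · rw [abs_le]; constructor <;> linarith
      _ = _ := by ring
  have hp : 0 < 1 + |x * (k + 1) - l| := by positivity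
  have h1 : (1 + |x - loc θ m| / scale θ m) ^ (-β) ≤ 2 ^ β * (1 + |x * (k + 1) - l|) ^ (-β) := by
    have e : (2:ℝ) ^ β * (1 + |x * (k + 1) - l|) ^ (-β) = ((1 + |x * (k + 1) - l|) / 2) ^ (-β) := by
      rw [Real.div_rpow hp.le (by norm_num), Real.rpow_neg (by norm_num : (0:ℝ) ≤ 2), div_inv_eq_mul,
        mul_comm]
    rw [e]
    apply Real.rpow_le_rpow_of_nonpos (by positivity) _ (by linarith)
    linarith
  calc C / scale θ m * (1 + |x - loc θ m| / scale θ m) ^ (-β)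
      ≤ C * (k + 1) * (2 ^ β * (1 + |x * (k + 1) - l|) ^ (-β)) := by
        rw [div_eq_mul_one_div]; gcongr
    _ = _ := by ring

/-- The affinity of a grid bracket is of the order of the square root of its scale. -/
lemma exists_affinity_gridBracket_le {C β : ℝ} (hC : 0 ≤ C) (hβ : 2 < β) {f : ℝ → ENNReal} {F : ℝ}
    (hfF : ∀ x, f x ≤ ENNReal.ofReal F) :
    ∃ D : ℝ, 0 ≤ D ∧ ∀ k l, affinity f (gridBracket C β k l) ≤ ENNReal.ofReal (D / √(k + 1)) := by
  set I := ∫ y : ℝ, (1 + |y|) ^ (-(β / 2)) with hI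
  have hI0 : 0 ≤ I := integral_nonneg fun y => by positivity
  have hint := integrable_one_add_abs_rpow (p := β / 2) (by linarith)
  refine ⟨√F * √(C * 2 ^ β) * I, by positivity, fun k l => ?_⟩
  have hk : (0:ℝ) < k + 1 := by positivity
  have hint2 : Integrable (fun x : ℝ => (1 + |x * (k + 1) - l|) ^ (-(β / 2))) :=
    (hint.comp_sub_right (l : ℝ)).comp_mul_right' hk.ne'
  have hval : ∫ x : ℝ, (1 + |x * (k + 1) - l|) ^ (-(β / 2)) = I / (k + 1) := by
    rw [Measure.integral_comp_mul_right (fun y : ℝ => (1 + |y - l|) ^ (-(β / 2))) (k + 1 : ℝ),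
      integral_sub_right_eq_self (fun y : ℝ => (1 + |y|) ^ (-(β / 2))) (l : ℝ),
      abs_of_pos (by positivity), smul_eq_mul, ← hI]
    ring
  have h1 : affinity f (gridBracket C β k l) ≤
      ∫⁻ x : ℝ, ENNReal.ofReal (√F * √(C * 2 ^ β * (k + 1)) *
        (1 + |x * (k + 1) - l|) ^ (-(β / 2))) := by
    refine lintegral_mono fun x => ?_
    rw [gridBracket, ofReal_rpow_half_mul (by positivity) (by positivity), mul_comm,
      mul_assoc (√F), ENNReal.ofReal_mul (p := √F) (by positivity)]
    gcongr
    rcases le_total 0 F with h | h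
    · rw [Real.sqrt_eq_rpow, ← ENNReal.ofReal_rpow_of_nonneg h (by norm_num)]
      have := hfF x
      gcongr
    · have := hfF x
      rw [ENNReal.ofReal_of_nonpos h, nonpos_iff_eq_zero] at this
      simp [this]
  refine h1.trans ?_
  rw [← ofReal_integral_eq_lintegral_ofReal (hint2.const_mul _) (ae_of_all _ fun x => by positivity),
    integral_const_mul, hval]
  apply ENNReal.ofReal_le_ofReal
  rw [Real.sqrt_mul (by positivity)]
  have hsq : √((k:ℝ) + 1) * √(k + 1) = k + 1 := Real.mul_self_sqrt hk.le
  have hsp : 0 < √((k:ℝ) + 1) := Real.sqrt_pos.2 hk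
  rw [le_div_iff₀ hsp]
  apply le_of_eq
  calc _ = √F * √(C * 2 ^ β) * I * (√((k:ℝ) + 1) * √(k + 1)) / (k + 1) := by ring
    _ = _ := by rw [hsq]; field_simp

/-! ### Almost sure properties of the sample -/

section Sample

variable {Ω : Type*} [MeasurableSpace Ω] {P : Measure Ω} {X : ℕ → Ω → ℝ} {g : ℝ → ℝ}

lemma IsSample.lintegral_comp (hX : IsSample P X g) (hg : Measurable g) (i : ℕ) {w : ℝ → ENNReal}
    (hw : Measurable w) :
    ∫⁻ ω, w (X i ω) ∂P = ∫⁻ x, ENNReal.ofReal (g x) * w x := by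
  rw [← lintegral_map hw (hX.measurable i), hX.law i,
    lintegral_withDensity_eq_lintegral_mul _ (by fun_prop) hw]
  rfl

lemma IsSample.measure_preimage (hX : IsSample P X g) (i : ℕ) {s : Set ℝ}
    (hs : MeasurableSet s) : P (X i ⁻¹' s) = ∫⁻ x in s, ENNReal.ofReal (g x) := by
  rw [← Measure.map_apply (hX.measurable i) hs, hX.law i, withDensity_apply _ hs]

lemma IsSample.ae_pos (hX : IsSample P X g) (hg : Measurable g) :
    ∀ᵐ ω ∂P, ∀ i, 0 < g (X i ω) := by
  rw [ae_all_iff]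
  intro i
  have hs : MeasurableSet {x | ¬ 0 < g x} := (measurableSet_lt measurable_const hg).compl
  rw [ae_iff]
  refine (hX.measure_preimage i hs).trans ?_
  rw [setLIntegral_congr_fun hs (g := fun _ => 0)]
  · simp
  · intro x hx
    simpa using hx

/-- Borel–Cantelli for geometrically small probabilities. -/
lemma ae_eventually_not_of_le_exp {A B : ℕ → Ω → Prop} {D ε : ℝ} (k : ℕ) (hε : 0 < ε)
    (h : ∀ᶠ n : ℕ in atTop, P {ω | A n ω} ≤ ENNReal.ofReal (D * (n ^ k * Real.exp (-ε * n))))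
    (hAB : ∀ n ω, ¬ A n ω → B n ω) : ∀ᵐ ω ∂P, ∀ᶠ n in atTop, B n ω := by
  obtain ⟨N, hN⟩ := eventually_atTop.1 h
  have hsum : Summable fun n : ℕ => D * ((n:ℝ) ^ k * Real.exp (-ε * n)) :=
    (Real.summable_pow_mul_exp_neg_nat_mul k hε).mul_left D
  have hsum' : ∑' n : ℕ, P {ω | A (n + N) ω} ≠ ⊤ := by
    refine ne_top_of_le_ne_top ((summable_nat_add_iff N).2 hsum).tsum_ofReal_ne_top ?_
    exact ENNReal.tsum_le_tsum fun n => hN _ (Nat.le_add_left _ _)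
  filter_upwards [ae_eventually_notMem hsum'] with ω hω
  obtain ⟨K, hK⟩ := eventually_atTop.1 hω
  refine eventually_atTop.2 ⟨K + N, fun n hn => hAB n ω ?_⟩
  have := hK (n - N) (by omega)
  simpa [Nat.sub_add_cancel (show N ≤ n by omega)] using this

/-- The likelihood ratio of a fixed function `u` against the true density is exponentially small
when the affinity is less than `1`: Markov's inequality for its square root. -/
lemma IsSample.measure_prod_le (hX : IsSample P X g) (hg : Measurable g) {u : ℝ → ENNReal}
    (hu : Measurable u) (K : ENNReal) (n : ℕ) :
    P {ω | ∏ i ∈ Finset.range n, ENNReal.ofReal (g (X i ω)) ≤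
        K * ∏ i ∈ Finset.range n, u (X i ω)} ≤
      K ^ (1 / 2 : ℝ) * affinity (fun x => ENNReal.ofReal (g x)) u ^ n := by
  set f : ℝ → ENNReal := fun x => ENNReal.ofReal (g x) with hf
  have hfm : Measurable f := by fun_prop
  set w : ℝ → ENNReal := fun x => (u x / f x) ^ (1 / 2 : ℝ) with hw
  have hwm : Measurable w := by fun_prop
  have hle : ∫⁻ x, f x * w x ≤ affinity f u := by
    refine lintegral_mono fun x => ?_
    -- Where `f` vanishes, `w` may be infinite, but `0 * ⊤ = 0`.
    by_cases h0 : f x = 0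
    · simp [h0]
    · have htop : f x ≠ ⊤ := ENNReal.ofReal_ne_top
      have hsplit : f x = f x ^ (1 / 2 : ℝ) * f x ^ (1 / 2 : ℝ) := by
        rw [← ENNReal.rpow_add _ _ h0 htop]; norm_num
      have h2 : f x ^ (1 / 2 : ℝ) * w x = u x ^ (1 / 2 : ℝ) := by
        rw [hw, ← ENNReal.mul_rpow_of_nonneg _ _ (by norm_num), ENNReal.mul_div_cancel h0 htop]
      have h3 : f x * w x = u x ^ (1 / 2 : ℝ) * f x ^ (1 / 2 : ℝ) := by
        nth_rw 1 [hsplit]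
        rw [mul_assoc, h2, mul_comm]
      exact h3.le
  have hsub : {ω | ∏ i ∈ Finset.range n, f (X i ω) ≤ K * ∏ i ∈ Finset.range n, u (X i ω)} ≤ᵐ[P]
      {ω | 1 ≤ K ^ (1 / 2 : ℝ) * ∏ i ∈ Finset.range n, w (X i ω)} := by
    filter_upwards [hX.ae_pos hg] with ω hω h
    change ∏ i ∈ Finset.range n, f (X i ω) ≤ K * ∏ i ∈ Finset.range n, u (X i ω) at h
    change 1 ≤ K ^ (1 / 2 : ℝ) * ∏ i ∈ Finset.range n, w (X i ω)
    have hf0 : ∀ i, f (X i ω) ≠ 0 := fun i => (ENNReal.ofReal_pos.2 (hω i)).ne'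
    have hft : ∀ i, f (X i ω) ≠ ⊤ := fun i => ENNReal.ofReal_ne_top
    rw [hw]
    dsimp only
    rw [ENNReal.prod_rpow_of_nonneg (by norm_num), ← ENNReal.mul_rpow_of_nonneg _ _ (by norm_num)]
    refine ENNReal.one_le_rpow ?_ (by norm_num)
    have hprod0 : ∏ i ∈ Finset.range n, f (X i ω) ≠ 0 := Finset.prod_ne_zero_iff.2 fun i _ => hf0 i
    have hprodt : ∏ i ∈ Finset.range n, f (X i ω) ≠ ⊤ := ENNReal.prod_ne_top fun i _ => hft i
    have e : ∏ i ∈ Finset.range n, u (X i ω) =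
        (∏ i ∈ Finset.range n, u (X i ω) / f (X i ω)) * ∏ i ∈ Finset.range n, f (X i ω) := by
      rw [← Finset.prod_mul_distrib]
      exact Finset.prod_congr rfl fun i _ => (ENNReal.div_mul_cancel (hf0 i) (hft i)).symm
    rw [e, ← mul_assoc] at h
    by_contra hlt
    rw [not_le] at hlt
    have := ENNReal.mul_lt_mul_left hprod0 hprodt hlt
    rw [one_mul] at this
    exact absurd h (not_le.2 this)
  refine (measure_mono_ae hsub).trans ?_
  have hmeas : Measurable fun ω => ∏ i ∈ Finset.range n, w (X i ω) :=
    Finset.measurable_prod _ fun i _ => hwm.comp (hX.measurable i)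
  have hmark := mul_meas_ge_le_lintegral₀ (μ := P)
    (f := fun ω => K ^ (1 / 2 : ℝ) * ∏ i ∈ Finset.range n, w (X i ω))
    (hmeas.const_mul _).aemeasurable 1
  rw [one_mul, lintegral_const_mul _ hmeas] at hmark
  refine hmark.trans ?_
  gcongr
  have hind : iIndepFun (fun i ω => w (X i ω)) P := hX.indep.comp (fun _ => w) fun _ => hwm
  rw [lintegral_prod_eq_prod_lintegral_of_indepFun _ _ hind fun i => hwm.comp (hX.measurable i)]
  calc ∏ i ∈ Finset.range n, ∫⁻ ω, w (X i ω) ∂P ≤ ∏ _i ∈ Finset.range n, affinity f u := by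
        refine Finset.prod_le_prod' fun i _ => ?_
        rw [hX.lintegral_comp hg i hwm]
        exact hle
    _ = affinity f u ^ n := by simp

/-- Simultaneously over an exponentially growing family of functions of affinity less than `1`, the
true density eventually has the larger likelihood. -/
lemma IsSample.ae_eventually_prod_lt (hX : IsSample P X g) (hg : Measurable g) {ι : Type*}
    (S : ℕ → Finset ι) (u : ι → ℝ → ENNReal) (hu : ∀ b, Measurable (u b)) {A ε : ℝ} (hε : 0 < ε)
    (hcard : ∀ᶠ n : ℕ in atTop, ((S n).card : ℝ) ≤ A * Real.exp (ε * n))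
    (haff : ∀ n, ∀ b ∈ S n, affinity (fun x => ENNReal.ofReal (g x)) (u b) ≤
      ENNReal.ofReal (Real.exp (-(2 * ε)))) (K : ℝ) :
    ∀ᵐ ω ∂P, ∀ᶠ n in atTop, ∀ b ∈ S n, ENNReal.ofReal K * ∏ i ∈ Finset.range n, u b (X i ω) <
      ∏ i ∈ Finset.range n, ENNReal.ofReal (g (X i ω)) := by
  have hK : 0 ≤ max K 0 := le_max_right _ _
  refine ae_eventually_not_of_le_exp
    (A := fun n ω => ∃ b ∈ S n, ∏ i ∈ Finset.range n, ENNReal.ofReal (g (X i ω)) ≤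
      ENNReal.ofReal K * ∏ i ∈ Finset.range n, u b (X i ω))
    (D := A * √(max K 0)) 0 hε ?_ ?_
  · filter_upwards [hcard] with n hn
    have hset : {ω | ∃ b ∈ S n, ∏ i ∈ Finset.range n, ENNReal.ofReal (g (X i ω)) ≤
        ENNReal.ofReal K * ∏ i ∈ Finset.range n, u b (X i ω)} =
        ⋃ b ∈ S n, {ω | ∏ i ∈ Finset.range n, ENNReal.ofReal (g (X i ω)) ≤
          ENNReal.ofReal K * ∏ i ∈ Finset.range n, u b (X i ω)} := by
      ext ω; simp
    rw [hset]
    have hKe : ENNReal.ofReal K ^ (1 / 2 : ℝ) = ENNReal.ofReal (√(max K 0)) := by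
      rw [Real.sqrt_eq_rpow, ← ENNReal.ofReal_rpow_of_nonneg hK (by norm_num)]
      rcases le_total K 0 with h | h
      · simp [h, ENNReal.ofReal_of_nonpos h]
      · simp [h]
    calc P (⋃ b ∈ S n, {ω | ∏ i ∈ Finset.range n, ENNReal.ofReal (g (X i ω)) ≤
          ENNReal.ofReal K * ∏ i ∈ Finset.range n, u b (X i ω)})
        ≤ ∑ b ∈ S n, ENNReal.ofReal (√(max K 0)) * ENNReal.ofReal (Real.exp (-(2 * ε))) ^ n := by
          refine (measure_biUnion_finset_le _ _).trans (Finset.sum_le_sum fun b hb => ?_)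
          refine (hX.measure_prod_le hg (hu b) _ n).trans ?_
          rw [hKe]
          gcongr
          exact haff n b hb
      _ = ENNReal.ofReal ((S n).card * (√(max K 0) * Real.exp (-(2 * ε)) ^ n)) := by
          rw [Finset.sum_const, nsmul_eq_mul, ENNReal.ofReal_mul (by positivity),
            ENNReal.ofReal_mul (by positivity), ENNReal.ofReal_pow (by positivity),
            ENNReal.ofReal_natCast]
      _ ≤ _ := by
          apply ENNReal.ofReal_le_ofReal
          calc ((S n).card : ℝ) * (√(max K 0) * Real.exp (-(2 * ε)) ^ n)
              ≤ A * Real.exp (ε * n) * (√(max K 0) * Real.exp (-(2 * ε)) ^ n) := by gcongr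
            _ = A * √(max K 0) * (n ^ 0 * (Real.exp (ε * n) * Real.exp (-(2 * ε)) ^ n)) := by ring
            _ = _ := by
              rw [← Real.exp_nat_mul, ← Real.exp_add]; congr 3; ring_nf
  · intro n ω h b hb
    by_contra hlt
    exact h ⟨b, hb, not_lt.1 hlt⟩

/-- A sample from a bounded density stays exponentially separated. -/
lemma IsSample.ae_eventually_separated [IsProbabilityMeasure P] (hX : IsSample P X g)
    {F : ℝ} (hgF : ∀ x, g x ≤ F) {ε : ℝ} (hε : 0 < ε) :
    ∀ᵐ ω ∂P, ∀ᶠ n : ℕ in atTop, ∀ i < n, ∀ j < n, i ≠ j →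
      2 * Real.exp (-ε * n) ≤ |X i ω - X j ω| := by
  have hpair : ∀ i j, i ≠ j → ∀ h : ℝ, 0 ≤ h → P {ω | |X i ω - X j ω| < h} ≤
      ENNReal.ofReal (2 * max F 0 * h) := by
    intro i j hij h hh
    have hms : MeasurableSet {p : ℝ × ℝ | |p.1 - p.2| < h} :=
      measurableSet_lt (by fun_prop) measurable_const
    have hi := (indepFun_iff_map_prod_eq_prod_map_map (hX.measurable i).aemeasurable
      (hX.measurable j).aemeasurable).1 (hX.indep.indepFun hij)
    have hXi := hX.measurable i
    have hXj := hX.measurable j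
    have : IsProbabilityMeasure (P.map (X i)) := Measure.isProbabilityMeasure_map hXi.aemeasurable
    have : IsProbabilityMeasure (P.map (X j)) := Measure.isProbabilityMeasure_map hXj.aemeasurable
    have e : {ω | |X i ω - X j ω| < h} = (fun ω => (X i ω, X j ω)) ⁻¹' {p | |p.1 - p.2| < h} := rfl
    rw [e, ← Measure.map_apply (hXi.prodMk hXj) hms, hi, Measure.prod_apply hms]
    calc ∫⁻ x, P.map (X j) (Prod.mk x ⁻¹' {p : ℝ × ℝ | |p.1 - p.2| < h}) ∂P.map (X i)
        ≤ ∫⁻ _x, ENNReal.ofReal (2 * max F 0 * h) ∂P.map (X i) := by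
          refine lintegral_mono fun x => ?_
          have e2 : Prod.mk x ⁻¹' {p : ℝ × ℝ | |p.1 - p.2| < h} = Metric.ball x h := by
            ext y
            simp [Real.dist_eq, abs_sub_comm]
          rw [e2, hX.law j, withDensity_apply _ measurableSet_ball]
          calc ∫⁻ y in Metric.ball x h, ENNReal.ofReal (g y)
              ≤ ∫⁻ _y in Metric.ball x h, ENNReal.ofReal (max F 0) :=
                lintegral_mono fun y => ENNReal.ofReal_le_ofReal ((hgF y).trans (le_max_left _ _))
            _ = _ := by
                rw [setLIntegral_const, Real.volume_ball, ← ENNReal.ofReal_mul (le_max_right _ _)]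
                congr 1; ring
      _ = _ := by simp
  refine ae_eventually_not_of_le_exp
    (A := fun n ω => ∃ i < n, ∃ j < n, i ≠ j ∧ |X i ω - X j ω| < 2 * Real.exp (-ε * n))
    (D := 4 * max F 0) 2 hε (Eventually.of_forall fun n => ?_) ?_
  · have hsub : {ω | ∃ i < n, ∃ j < n, i ≠ j ∧ |X i ω - X j ω| < 2 * Real.exp (-ε * n)} ⊆
        ⋃ p ∈ (Finset.range n ×ˢ Finset.range n).filter fun p => p.1 ≠ p.2,
          {ω | |X p.1 ω - X p.2 ω| < 2 * Real.exp (-ε * n)} := by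
      rintro ω ⟨i, hi, j, hj, hij, h⟩
      simp only [Set.mem_iUnion]
      exact ⟨(i, j), by simp [hi, hj, hij], h⟩
    have hcard : (((Finset.range n ×ˢ Finset.range n).filter fun p => p.1 ≠ p.2).card : ℝ) ≤
        (n : ℝ) ^ 2 := by
      have := Finset.card_filter_le (Finset.range n ×ˢ Finset.range n) (fun p => p.1 ≠ p.2)
      rw [Finset.card_product, Finset.card_range, ← sq] at this
      exact_mod_cast this
    calc _ ≤ _ := measure_mono hsub
      _ ≤ ∑ p ∈ (Finset.range n ×ˢ Finset.range n).filter fun p => p.1 ≠ p.2,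
          ENNReal.ofReal (2 * max F 0 * (2 * Real.exp (-ε * n))) := by
        refine (measure_biUnion_finset_le _ _).trans (Finset.sum_le_sum fun p hp => ?_)
        exact hpair _ _ (Finset.mem_filter.1 hp).2 _ (by positivity)
      _ ≤ _ := by
        rw [Finset.sum_const, nsmul_eq_mul, ← ENNReal.ofReal_natCast,
          ← ENNReal.ofReal_mul (by positivity)]
        apply ENNReal.ofReal_le_ofReal
        calc _ ≤ (n:ℝ) ^ 2 * (2 * max F 0 * (2 * Real.exp (-ε * n))) := by gcongr
          _ = _ := by ring
  · intro n ω h i hi j hj hij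
    by_contra hlt
    exact h ⟨i, hi, j, hj, hij, not_le.1 hlt⟩

/-- A sample from a density with tails of order `|x| ^ (-β)` has subexponential range. -/
lemma IsSample.ae_eventually_abs_le (hX : IsSample P X g) (hg : Measurable g) {F β : ℝ}
    (hβ : 2 < β) (hF : 0 ≤ F) (hgF : ∀ x, g x ≤ F * (1 + |x|) ^ (-β)) {ε : ℝ} (hε : 0 < ε) :
    ∀ᵐ ω ∂P, ∀ᶠ n : ℕ in atTop, ∀ i < n, |X i ω| ≤ Real.exp (ε * n) := by
  -- The moment of order `1 / 2` is finite, so Markov's inequality gives exponential bounds.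
  set w : ℝ → ENNReal := fun x => ENNReal.ofReal ((1 + |x|) ^ (1 / 2 : ℝ)) with hw
  have hwm : Measurable w := by fun_prop
  have hint := (integrable_one_add_abs_rpow (p := β - 1 / 2) (by linarith)).const_mul F
  set W := ∫ x : ℝ, F * (1 + |x|) ^ (-(β - 1 / 2)) with hW
  have hmom : ∀ i, ∫⁻ ω, w (X i ω) ∂P ≤ ENNReal.ofReal W := by
    intro i
    rw [hX.lintegral_comp hg i hwm, hW, ofReal_integral_eq_lintegral_ofReal hint
      (ae_of_all _ fun x => by positivity)]
    refine lintegral_mono fun x => ?_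
    rw [hw]
    dsimp only
    rw [← ENNReal.ofReal_mul' (by positivity)]
    apply ENNReal.ofReal_le_ofReal
    calc g x * (1 + |x|) ^ (1 / 2 : ℝ) ≤ F * (1 + |x|) ^ (-β) * (1 + |x|) ^ (1 / 2 : ℝ) := by
          gcongr; exact hgF x
      _ = _ := by
          rw [mul_assoc, ← Real.rpow_add (by positivity)]; congr 2; ring
  have hone : ∀ i, ∀ t : ℝ, 0 < t → P {ω | t ^ 2 < |X i ω|} ≤ ENNReal.ofReal (W / t) := by
    intro i t ht
    have hm := mul_meas_ge_le_lintegral₀ (μ := P) (hwm.comp (hX.measurable i)).aemeasurable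
      (ENNReal.ofReal t)
    have h1 : P {ω | t ^ 2 < |X i ω|} ≤ P {ω | ENNReal.ofReal t ≤ (w ∘ X i) ω} := by
      refine measure_mono fun ω (hω : t ^ 2 < |X i ω|) => ?_
      apply ENNReal.ofReal_le_ofReal
      rw [← Real.sqrt_eq_rpow]
      apply Real.le_sqrt_of_sq_le
      linarith
    rw [ENNReal.ofReal_div_of_pos ht, ENNReal.le_div_iff_mul_le (by simp [ht]) (by simp), mul_comm]
    calc _ ≤ ENNReal.ofReal t * P {ω | ENNReal.ofReal t ≤ (w ∘ X i) ω} := by gcongr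
      _ ≤ _ := hm
      _ ≤ _ := hmom i
  refine ae_eventually_not_of_le_exp
    (A := fun n ω => ∃ i < n, Real.exp (ε * n) < |X i ω|)
    (D := W) 1 (half_pos hε) (Eventually.of_forall fun n => ?_) ?_
  · have hsub : {ω | ∃ i < n, Real.exp (ε * n) < |X i ω|} ⊆
        ⋃ i ∈ Finset.range n, {ω | Real.exp (ε / 2 * n) ^ 2 < |X i ω|} := by
      rintro ω ⟨i, hi, h⟩
      simp only [Set.mem_iUnion]
      refine ⟨i, by simp [hi], ?_⟩
      change Real.exp (ε / 2 * n) ^ 2 < |X i ω|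
      rw [← Real.exp_nat_mul]
      convert h using 2
      push_cast; ring
    calc _ ≤ _ := measure_mono hsub
      _ ≤ ∑ i ∈ Finset.range n, ENNReal.ofReal (W / Real.exp (ε / 2 * n)) := by
        refine (measure_biUnion_finset_le _ _).trans (Finset.sum_le_sum fun i _ => ?_)
        exact hone i _ (Real.exp_pos _)
      _ = _ := by
        rw [Finset.sum_const, nsmul_eq_mul, ← ENNReal.ofReal_natCast,
          ← ENNReal.ofReal_mul (by positivity), Finset.card_range]
        congr 1
        rw [neg_mul, Real.exp_neg]
        ring
  · intro n ω h i hi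
    by_contra hlt
    exact h ⟨i, hi, not_le.1 hlt⟩

end Sample

/-! ### Likelihood bounds for a fixed sample -/

section Deterministic

variable {M : ℕ} {φ : Fin M → ℝ → ℝ} {C β : ℝ} {θ : Vec M}

/-- The upper function `g + η + ∑ grid brackets` for mixtures whose components of regular scale are
dominated by `g`. -/
noncomputable def bracket (C β : ℝ) (g : ℝ → ENNReal) (η : ℝ) (b : Fin M → ℕ × ℤ) : ℝ → ENNReal :=
  g + (fun _ => ENNReal.ofReal η) + ∑ m, gridBracket C β (b m).1 (b m).2

lemma bracket_apply (C β : ℝ) (g : ℝ → ENNReal) (η : ℝ) (b : Fin M → ℕ × ℤ) (x : ℝ) :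
    bracket C β g η b x =
      g x + ENNReal.ofReal η + ∑ m, gridBracket C β (b m).1 (b m).2 x := by
  simp [bracket]

lemma measurable_bracket {g : ℝ → ENNReal} (hg : Measurable g) (C β η : ℝ) (b : Fin M → ℕ × ℤ) :
    Measurable (bracket C β g η b) := by
  rw [funext (bracket_apply C β g η b)]
  exact (hg.add measurable_const).add
    (Finset.measurable_sum _ fun _ _ => measurable_gridBracket _ _ _ _)

lemma affinity_bracket_le {f g : ℝ → ENNReal} (hf : Measurable f) (hg : Measurable g) {η D k₀ : ℝ}
    (hD : 0 ≤ D) (hk₀ : 0 < k₀ + 1)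
    (hgrid : ∀ k l, affinity f (gridBracket C β k l) ≤ ENNReal.ofReal (D / √(k + 1)))
    {b : Fin M → ℕ × ℤ} (hb : ∀ m, k₀ ≤ (b m).1) :
    affinity f (bracket C β g η b) ≤
      affinity f g + affinity f (fun _ => ENNReal.ofReal η) +
        ENNReal.ofReal (M * (D / √(k₀ + 1))) := by
  refine (affinity_add_le hf (hg.add measurable_const).aemeasurable).trans ?_
  gcongr
  · exact affinity_add_le hf hg.aemeasurable
  · refine (affinity_sum_le hf _ _ fun m _ => (measurable_gridBracket _ _ _ _).aemeasurable).trans ?_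
    calc ∑ m, affinity f (gridBracket C β (b m).1 (b m).2)
        ≤ ∑ _m : Fin M, ENNReal.ofReal (D / √(k₀ + 1)) := by
          refine Finset.sum_le_sum fun m _ => (hgrid _ _).trans (ENNReal.ofReal_le_ofReal ?_)
          have := hb m
          gcongr
      _ = _ := by
          rw [Finset.sum_const, nsmul_eq_mul, ENNReal.ofReal_mul (by positivity)]
          simp

/-- The labels of the brackets that cover the components with scale at least `1 / q` and location at
most `2 * q`. -/
noncomputable def bracketLabels (M k₀ q : ℕ) : Finset (Fin M → ℕ × ℤ) :=
  Fintype.piFinset fun _ => Finset.Icc k₀ q ×ˢ Finset.Icc (-(5 * (q : ℤ) ^ 2)) (5 * (q : ℤ) ^ 2)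

lemma card_bracketLabels_le (M k₀ : ℕ) {q : ℕ} (hq : 1 ≤ q) :
    (bracketLabels M k₀ q).card ≤ (22 * q ^ 3) ^ M := by
  rw [bracketLabels, Fintype.card_piFinset]
  simp only [Finset.card_product, Nat.card_Icc, Int.card_Icc, Finset.prod_const, Finset.card_univ,
    Fintype.card_fin]
  have e : (5 * (q : ℤ) ^ 2 + 1 - -(5 * (q : ℤ) ^ 2)).toNat = 10 * q ^ 2 + 1 := by
    have : (5 * (q : ℤ) ^ 2 + 1 - -(5 * (q : ℤ) ^ 2)) = ((10 * q ^ 2 + 1 : ℕ) : ℤ) := by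
      push_cast; ring
    rw [this, Int.toNat_natCast]
  rw [e]
  refine Nat.pow_le_pow_left ?_ M
  have h2 : 1 ≤ q ^ 2 := Nat.one_le_pow _ _ hq
  calc (q + 1 - k₀) * (10 * q ^ 2 + 1) ≤ (2 * q) * (11 * q ^ 2) := by
        apply Nat.mul_le_mul <;> omega
    _ = 22 * q ^ 3 := by ring

/-- A component of small scale is dominated by a grid bracket, by a constant because it is too
concentrated and away from `x`, or by a constant because its location is too remote. -/
lemma exists_bracketLabels_dominating (henv : HasEnvelope φ C β) (hC : 0 ≤ C) (hβ : 2 ≤ β)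
    (hθ : θ ∈ paramSpace M) {g : ℝ → ENNReal} {A : Finset (Fin M)}
    (hdom : ∀ x, ENNReal.ofReal (mixDensity φ θ x) ≤
      g x + ∑ m ∈ A, ENNReal.ofReal (component φ θ m x))
    {k₀ q : ℕ} (hk₀q : k₀ ≤ q) (hsmall : ∀ m ∈ A, scale θ m < 1 / (k₀ + 1)) {Q r η : ℝ}
    (hQ : 1 ≤ Q) (hQq : Q ≤ q) (hr : 0 < r) (hη : 0 ≤ η)
    (hη₁ : C * Q⁻¹ / r ^ 2 ≤ η / (M + 1)) (hη₂ : C / Q ^ 2 ≤ η / (M + 1)) :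
    ∃ b ∈ bracketLabels M k₀ q, ∀ x, |x| ≤ Q →
      (∀ m ∈ A, scale θ m < Q⁻¹ → r ≤ |x - loc θ m|) →
      ENNReal.ofReal (mixDensity φ θ x) ≤ bracket C β g η b x := by
  classical
  have hq1 : (1:ℝ) ≤ q := hQ.trans hQq
  set k : Fin M → ℕ := fun m => ⌊1 / scale θ m⌋₊ with hk
  set l : Fin M → ℤ := fun m => ⌊loc θ m * (k m + 1)⌋ with hl
  -- Components that need no bracket of their own receive the admissible label `(k₀, 0)`.
  set b : Fin M → ℕ × ℤ := fun m =>
    if m ∈ A ∧ Q⁻¹ ≤ scale θ m ∧ |loc θ m| ≤ 2 * Q then (k m, l m) else (k₀, 0) with hb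
  refine ⟨b, ?_, fun x hx hfar => ?_⟩
  · rw [bracketLabels, Fintype.mem_piFinset]
    intro m
    by_cases hm : m ∈ A ∧ Q⁻¹ ≤ scale θ m ∧ |loc θ m| ≤ 2 * Q
    · have hs := hθ.2.2 m
      obtain ⟨hmA, hmQ, hmloc⟩ := hm
      have hkQ : (k m : ℝ) ≤ Q := by
        calc (k m : ℝ) ≤ 1 / scale θ m := Nat.floor_le (by positivity)
          _ ≤ Q := by rw [one_div]; exact inv_le_of_inv_le₀ (by linarith) hmQ
      have hkl : k₀ ≤ k m := by
        apply Nat.le_floor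
        have := hsmall m hmA
        rw [lt_div_iff₀ (by positivity)] at this
        rw [le_div_iff₀ hs]
        linarith
      have habs : |loc θ m * (k m + 1)| ≤ 4 * (q:ℝ) ^ 2 := by
        rw [abs_mul, abs_of_nonneg (by positivity : (0:ℝ) ≤ k m + 1)]
        calc |loc θ m| * ((k m : ℝ) + 1) ≤ (2 * q) * (q + q) := by
              have h1 : (k m : ℝ) ≤ q := hkQ.trans hQq
              exact mul_le_mul (by linarith) (by linarith) (by positivity) (by positivity)
          _ = _ := by ring
      rw [abs_le] at habs
      have hq2 : (1:ℝ) ≤ (q:ℝ) ^ 2 := one_le_pow₀ hq1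
      have hl1 : l m ≤ 5 * (q : ℤ) ^ 2 := by
        have h1 : (l m : ℝ) ≤ loc θ m * (k m + 1) := Int.floor_le _
        have : (l m : ℝ) ≤ ((5 * (q : ℤ) ^ 2 : ℤ) : ℝ) := by push_cast; linarith
        exact_mod_cast this
      have hl2 : -(5 * (q : ℤ) ^ 2) ≤ l m := by
        apply Int.le_floor.2
        push_cast; linarith
      have hbm : b m = (k m, l m) := by simp only [hb]; exact if_pos ⟨hmA, hmQ, hmloc⟩
      rw [hbm]
      simp only [Finset.mem_product, Finset.mem_Icc]
      exact ⟨⟨hkl, by exact_mod_cast hkQ.trans hQq⟩, hl2, hl1⟩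
    · have hbm : b m = (k₀, 0) := by simp only [hb]; exact if_neg hm
      rw [hbm]
      simp only [Finset.mem_product, Finset.mem_Icc]
      exact ⟨⟨le_rfl, hk₀q⟩, by simp, by positivity⟩
  · have hcomp : ∀ m ∈ A, ENNReal.ofReal (component φ θ m x) ≤
        ENNReal.ofReal (η / (M + 1)) + gridBracket C β (b m).1 (b m).2 x := by
      intro m hmA
      have hs := hθ.2.2 m
      have hs1 : scale θ m ≤ 1 := by
        refine (hsmall m hmA).le.trans ?_
        rw [div_le_one (by positivity)]; linarith [(Nat.cast_nonneg k₀ : (0:ℝ) ≤ k₀)]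
      rcases lt_or_ge (scale θ m) Q⁻¹ with htiny | htiny
      · refine le_add_right (ENNReal.ofReal_le_ofReal ?_)
        refine (component_le_of_far henv hC hβ hs hr (hfar m hmA htiny)).trans (le_trans ?_ hη₁)
        gcongr
      rcases lt_or_ge (2 * Q) |loc θ m| with hrem | hrem
      · refine le_add_right (ENNReal.ofReal_le_ofReal ?_)
        have hd : Q ≤ |x - loc θ m| := by
          have := abs_sub_abs_le_abs_sub (loc θ m) x
          rw [abs_sub_comm] at this
          linarith
        refine (component_le_of_far henv hC hβ hs (by linarith) hd).trans (le_trans ?_ hη₂)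
        gcongr
        exact mul_le_of_le_one_right hC hs1
      · have hbm : b m = (k m, l m) := by simp only [hb]; exact if_pos ⟨hmA, htiny, hrem⟩
        rw [hbm]
        exact le_add_left (component_le_gridBracket henv hC (by linarith) hs hs1 x)
    rw [bracket_apply, add_assoc]
    refine (hdom x).trans ?_
    gcongr
    refine (Finset.sum_le_sum hcomp).trans ?_
    rw [Finset.sum_add_distrib]
    gcongr
    · rw [Finset.sum_const, nsmul_eq_mul, ← ENNReal.ofReal_natCast,
        ← ENNReal.ofReal_mul (by positivity)]
      apply ENNReal.ofReal_le_ofReal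
      rw [mul_div_assoc', div_le_iff₀ (by positivity), mul_comm]
      gcongr
      have : A.card ≤ M := by simpa using Finset.card_le_univ A
      have : (A.card : ℝ) ≤ M := by exact_mod_cast this
      linarith
    · exact Finset.subset_univ A

/-- A factorwise bound of a product that fails at few indices costs few extra factors. -/
lemma prod_le_pow_mul_prod {R : Type*} [CommSemiring R] [PartialOrder R] [IsOrderedRing R]
    {n N : ℕ} {a u : ℕ → R} {D : R} (S : Finset ℕ) (hS : S.card ≤ N) (hD : 1 ≤ D)
    (ha : ∀ i < n, 0 ≤ a i) (hu : ∀ i < n, 0 ≤ u i) (h : ∀ i < n, i ∉ S → a i ≤ u i)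
    (hbad : ∀ i < n, a i ≤ D * u i) :
    ∏ i ∈ Finset.range n, a i ≤ D ^ N * ∏ i ∈ Finset.range n, u i := by
  classical
  calc ∏ i ∈ Finset.range n, a i
      ≤ ∏ i ∈ Finset.range n, (if i ∈ S then D else 1) * u i := by
        refine Finset.prod_le_prod (fun i hi => ha i (Finset.mem_range.1 hi)) fun i hi => ?_
        have hi' := Finset.mem_range.1 hi
        by_cases hiS : i ∈ S
        · rw [if_pos hiS]; exact hbad i hi'
        · rw [if_neg hiS, one_mul]; exact h i hi' hiS
    _ = D ^ ((Finset.range n).filter (· ∈ S)).card * ∏ i ∈ Finset.range n, u i := by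
        rw [Finset.prod_mul_distrib, Finset.prod_ite]
        simp
    _ ≤ _ := by
        refine mul_le_mul_of_nonneg_right (pow_le_pow_right₀ hD (le_trans ?_ hS))
          (Finset.prod_nonneg fun i hi => hu i (Finset.mem_range.1 hi))
        exact Finset.card_le_card fun i hi => (Finset.mem_filter.1 hi).2

/-- In a `2 * r`-separated sample, each location is within `r` of at most one observation. -/
lemma exists_card_le_of_separated (x : ℕ → ℝ) (μ : Fin M → ℝ) {n : ℕ} {r : ℝ}
    (hsep : ∀ i < n, ∀ j < n, i ≠ j → 2 * r ≤ |x i - x j|) :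
    ∃ S : Finset ℕ, S.card ≤ M ∧ ∀ i < n, i ∉ S → ∀ m, r ≤ |x i - μ m| := by
  classical
  refine ⟨(Finset.range n).filter fun i => ∃ m, |x i - μ m| < r, ?_, fun i hi hiS m => ?_⟩
  · have hch : ∀ i, ∃ o : Option (Fin M),
        (∃ m, |x i - μ m| < r) → ∃ m, o = some m ∧ |x i - μ m| < r := by
      intro i
      by_cases h : ∃ m, |x i - μ m| < r
      · obtain ⟨m, hm⟩ := h; exact ⟨some m, fun _ => ⟨m, rfl, hm⟩⟩
      · exact ⟨none, fun h' => absurd h' h⟩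
    choose o ho using hch
    calc _ ≤ (Finset.univ.image (some : Fin M → Option (Fin M))).card := by
          refine Finset.card_le_card_of_injOn o ?_ ?_
          · intro i hi
            obtain ⟨m, hm, -⟩ := ho i (Finset.mem_filter.1 hi).2
            simp [hm]
          · intro i hi j hj hij
            by_contra hne
            have hi' := Finset.mem_filter.1 hi
            have hj' := Finset.mem_filter.1 hj
            obtain ⟨m, hm, hmr⟩ := ho i hi'.2
            obtain ⟨m', hm', hmr'⟩ := ho j hj'.2
            have : m = m' := Option.some_injective _ (by rw [← hm, ← hm', hij])
            subst this
            have h1 := hsep i (Finset.mem_range.1 hi'.1) j (Finset.mem_range.1 hj'.1) hne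
            have h2 := abs_sub_le (x i) (μ m) (x j)
            rw [abs_sub_comm (μ m)] at h2
            linarith
      _ ≤ M := Finset.card_image_le.trans (by simp)
  · by_contra hlt
    exact hiS (Finset.mem_filter.2 ⟨Finset.mem_range.2 hi, m, not_le.1 hlt⟩)

/-- When all the scales are tiny, the data points that are not close to any location make the
likelihood superexponentially small; here `s` is the fourth root of the largest scale. -/
lemma penLikelihood_le_of_scales_tiny (hφ : ∀ m, IsProbDensity (φ m)) (henv : HasEnvelope φ C β)
    (hC : 0 ≤ C) (hβ : 2 ≤ β) (hθ : θ ∈ paramSpace M) {rbar : ℕ → ℝ → ℝ} {n : ℕ} {x : ℕ → ℝ}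
    {s r η : ℝ} (hs : 0 < s) (hs1 : s ≤ 1) (hsM : maxScale θ = s ^ 4) (hr : 0 ≤ r)
    (hrew : reward rbar n θ ≤ r * (minScale θ / maxScale θ) ^ M * Real.exp n)
    (hn : 6 * M ≤ n) (hη : Real.exp 1 * C * s ≤ η)
    (hsep : ∀ i < n, ∀ j < n, i ≠ j → 2 * s ≤ |x i - x j|) :
    penLikelihood φ rbar n x θ ≤ r * η ^ n := by
  have hmin := minScale_pos hθ
  obtain ⟨S, hScard, hS⟩ := exists_card_le_of_separated x (loc θ) hsep
  -- `D` is the ratio of the bound `C / minScale θ`, valid everywhere, to the bound `C * s ^ 2` far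
  -- from all the locations.
  set D := 1 / (minScale θ * s ^ 2) with hD
  have hmin1 : minScale θ ≤ 1 := by
    refine (minScale_le_maxScale hθ).trans ?_
    rw [hsM]; exact pow_le_one₀ hs.le hs1
  have hD1 : 1 ≤ D := by
    rw [hD, le_div_iff₀ (by positivity), one_mul]
    exact mul_le_one₀ hmin1 (by positivity) (pow_le_one₀ hs.le hs1)
  have hprod : ∏ i ∈ Finset.range n, mixDensity φ θ (x i) ≤
      D ^ M * ∏ _i ∈ Finset.range n, (C * s ^ 2) := by
    refine prod_le_pow_mul_prod S hScard hD1 (fun i _ => mixDensity_nonneg hφ hθ _)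
      (fun i _ => by positivity) (fun i hi hiS => ?_) fun i _ => ?_
    · refine mixDensity_le_of_component_le hθ fun m => ?_
      refine (component_le_of_far henv hC hβ (hθ.2.2 m) hs (hS i hi hiS m)).trans ?_
      rw [div_le_iff₀ (by positivity)]
      calc C * scale θ m ≤ C * s ^ 4 := by
            have := le_maxScale θ m
            rw [hsM] at this
            gcongr
        _ = _ := by ring
    · refine (mixDensity_le_div_minScale henv hC (by linarith) hθ _).trans (le_of_eq ?_)
      rw [hD]; field_simp
  rw [Finset.prod_const, Finset.card_range] at hprod
  have hx : 0 < Real.exp 1 := Real.exp_pos 1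
  calc penLikelihood φ rbar n x θ
      ≤ (D ^ M * (C * s ^ 2) ^ n) * (r * (minScale θ / maxScale θ) ^ M * Real.exp n) :=
        mul_le_mul_of_nonneg hprod hrew
          (Finset.prod_nonneg fun i _ => mixDensity_nonneg hφ hθ _)
          (by rw [hsM]; positivity)
    _ = r * (Real.exp 1 * C) ^ n * (s ^ (2 * n) / s ^ (6 * M)) := by
        have e : Real.exp n = Real.exp 1 ^ n := by rw [← Real.exp_nat_mul, mul_one]
        have e2 : (1 / (minScale θ * s ^ 2)) ^ M * (minScale θ / s ^ 4) ^ M =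
            1 / s ^ (6 * M) := by
          rw [← mul_pow, pow_mul, ← one_div_pow]
          congr 1; field_simp
        rw [e, hD, hsM, mul_pow C, mul_pow _ C, ← pow_mul]
        linear_combination (C ^ n * s ^ (2 * n) * r * Real.exp 1 ^ n) * e2
    _ ≤ r * (Real.exp 1 * C) ^ n * s ^ n := by
        gcongr
        rw [div_le_iff₀ (by positivity), ← pow_add]
        exact pow_le_pow_of_le_one hs.le hs1 (by omega)
    _ = r * (Real.exp 1 * C * s) ^ n := by rw [mul_pow _ s]; ring
    _ ≤ _ := by gcongr

end Deterministic

section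

variable {M : ℕ} {φ : Fin M → ℝ → ℝ} {C β : ℝ} {θ : Vec M}

/-- The penalized likelihood of a mixture that is dominated by `g` up to components of small scale
is at most a constant times the product of one of the brackets. The three regimes are: no tiny
scale; a tiny scale with a small reward, which pays for the few data points near the tiny
components; all scales tiny. -/
lemma exists_bracket_penLikelihood_le (hφ : ∀ m, IsProbDensity (φ m)) (henv : HasEnvelope φ C β)
    (hC : 0 ≤ C) (hβ : 2 ≤ β) (hθ : θ ∈ paramSpace M) {g : ℝ → ENNReal} {A : Finset (Fin M)}
    (hdom : ∀ x, ENNReal.ofReal (mixDensity φ θ x) ≤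
      g x + ∑ m ∈ A, ENNReal.ofReal (component φ θ m x))
    {k₀ q : ℕ} (hk₀q : k₀ ≤ q) (hsmall : ∀ m ∈ A, scale θ m < 1 / (k₀ + 1)) {Q r η : ℝ}
    (hQ : 1 ≤ Q) (hQq : Q ≤ q) (hr : 0 < r) (hη : 0 < η)
    (hη₁ : C * Q⁻¹ / r ^ 2 ≤ η / (M + 1)) (hη₂ : C / Q ^ 2 ≤ η / (M + 1))
    {rbar : ℕ → ℝ → ℝ} {n : ℕ} {R ρ : ℝ} (hrew₀ : 0 ≤ reward rbar n θ) (hR : reward rbar n θ ≤ R)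
    (hρ : 0 ≤ ρ) (hrew : reward rbar n θ ≤ ρ * (minScale θ / maxScale θ) ^ M * Real.exp n)
    (hn : 6 * M ≤ n) {x : ℕ → ℝ} (hx : ∀ i < n, |x i| ≤ Q)
    (hsep₁ : ∀ i < n, ∀ j < n, i ≠ j → 2 * r ≤ |x i - x j|) {s : ℝ} (hs : 0 ≤ s) (hs1 : s ≤ 1)
    (hsep₂ : ∀ i < n, ∀ j < n, i ≠ j → 2 * s ≤ |x i - x j|) (hsη : Real.exp 1 * C * s ≤ η)
    (hscale : minScale θ < Q⁻¹ → minScale θ ^ M < reward rbar n θ → maxScale θ ≤ s ^ 4) :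
    ∃ b ∈ bracketLabels M k₀ q, ENNReal.ofReal (penLikelihood φ rbar n x θ) ≤
      ENNReal.ofReal (R + ρ + max 1 (C / η) ^ M) *
        ∏ i ∈ Finset.range n, bracket C β g η b (x i) := by
  obtain ⟨b, hb, hbx⟩ := exists_bracketLabels_dominating henv hC hβ hθ hdom hk₀q hsmall hQ hQq hr
    hη.le hη₁ hη₂
  refine ⟨b, hb, ?_⟩
  have hR0 : 0 ≤ R := hrew₀.trans hR
  have hmin := minScale_pos hθ
  set K := R + ρ + max 1 (C / η) ^ M with hK
  have hK1 : 0 ≤ max 1 (C / η) ^ M := by positivity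
  have hfac : ENNReal.ofReal (penLikelihood φ rbar n x θ) =
      (∏ i ∈ Finset.range n, ENNReal.ofReal (mixDensity φ θ (x i))) *
        ENNReal.ofReal (reward rbar n θ) := by
    rw [penLikelihood, ENNReal.ofReal_mul' hrew₀,
      ENNReal.ofReal_prod_of_nonneg fun i _ => mixDensity_nonneg hφ hθ _]
  by_cases htiny : ∃ m ∈ A, scale θ m < Q⁻¹
  · obtain ⟨m₀, -, hm₀⟩ := htiny
    have hminQ : minScale θ < Q⁻¹ := (minScale_le θ m₀).trans_lt hm₀
    have hmin1 : minScale θ ≤ 1 := hminQ.le.trans (inv_le_one_of_one_le₀ hQ)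
    rcases lt_or_ge (minScale θ ^ M) (reward rbar n θ) with hcase | hcase
    · have hmax : 0 < maxScale θ := hmin.trans_le (minScale_le_maxScale hθ)
      have h4 : (√√(maxScale θ)) ^ 4 = maxScale θ := by
        rw [show (√√(maxScale θ)) ^ 4 = ((√√(maxScale θ)) ^ 2) ^ 2 by ring,
          Real.sq_sqrt (Real.sqrt_nonneg _), Real.sq_sqrt hmax.le]
      have hts : √√(maxScale θ) ≤ s :=
        (pow_le_pow_iff_left₀ (by positivity) hs (by norm_num)).1 (h4.le.trans (hscale hminQ hcase))
      have hpen := penLikelihood_le_of_scales_tiny (x := x) (s := √√(maxScale θ)) (η := η) hφ henv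
        hC hβ hθ
        (by positivity) (hts.trans hs1) h4.symm hρ hrew hn
        (le_trans (by gcongr) hsη)
        (fun i hi j hj hij => le_trans (by gcongr) (hsep₂ i hi j hj hij))
      calc ENNReal.ofReal (penLikelihood φ rbar n x θ)
          ≤ ENNReal.ofReal ρ * ∏ _i ∈ Finset.range n, ENNReal.ofReal η := by
            refine (ENNReal.ofReal_le_ofReal hpen).trans (le_of_eq ?_)
            rw [ENNReal.ofReal_mul hρ, ENNReal.ofReal_pow hη.le, Finset.prod_const,
              Finset.card_range]
        _ ≤ _ := by
            gcongr with i hi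
            · rw [hK]; linarith
            · rw [bracket_apply]
              exact le_add_right le_add_self
    · obtain ⟨S, hScard, hS⟩ := exists_card_le_of_separated x (loc θ) hsep₁
      -- `D * η` bounds the density everywhere, and `D ^ M * minScale θ ^ M` is bounded.
      set D := max 1 (C / (minScale θ * η)) with hD
      have hD1 : 1 ≤ D := le_max_left _ _
      have hprod : ∏ i ∈ Finset.range n, ENNReal.ofReal (mixDensity φ θ (x i)) ≤
          ENNReal.ofReal D ^ M * ∏ i ∈ Finset.range n, bracket C β g η b (x i) := by
        refine prod_le_pow_mul_prod S hScard (by simpa using hD1) (fun _ _ => zero_le)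
          (fun _ _ => zero_le) (fun i hi hiS => hbx _ (hx i hi) fun m _ _ => hS i hi hiS m)
          fun i hi => ?_
        calc ENNReal.ofReal (mixDensity φ θ (x i)) ≤ ENNReal.ofReal (D * η) := by
              apply ENNReal.ofReal_le_ofReal
              refine (mixDensity_le_div_minScale henv hC (by linarith) hθ _).trans ?_
              calc C / minScale θ = C / (minScale θ * η) * η := by field_simp
                _ ≤ _ := by gcongr; exact le_max_right _ _
          _ = ENNReal.ofReal D * ENNReal.ofReal η := ENNReal.ofReal_mul (by linarith)
          _ ≤ _ := by
              gcongr
              rw [bracket_apply]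
              exact le_add_right le_add_self
      have hDK : D * minScale θ ≤ max 1 (C / η) := by
        rw [hD, max_mul_of_nonneg _ _ hmin.le]
        refine max_le_max (by linarith) (le_of_eq ?_)
        field_simp
      calc ENNReal.ofReal (penLikelihood φ rbar n x θ)
          ≤ (ENNReal.ofReal D ^ M * ∏ i ∈ Finset.range n, bracket C β g η b (x i)) *
              ENNReal.ofReal (minScale θ ^ M) := by
            rw [hfac]; gcongr
        _ = ENNReal.ofReal ((D * minScale θ) ^ M) *
              ∏ i ∈ Finset.range n, bracket C β g η b (x i) := by
            rw [mul_pow, ENNReal.ofReal_mul (by positivity), ENNReal.ofReal_pow (by linarith : 0 ≤ D)]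
            ring
        _ ≤ _ := by
            gcongr
            calc (D * minScale θ) ^ M ≤ max 1 (C / η) ^ M := by gcongr
              _ ≤ K := by rw [hK]; linarith
  · push Not at htiny
    calc ENNReal.ofReal (penLikelihood φ rbar n x θ)
        ≤ (∏ i ∈ Finset.range n, bracket C β g η b (x i)) * ENNReal.ofReal R := by
          rw [hfac]
          gcongr with i hi
          exact hbx _ (hx i (Finset.mem_range.1 hi)) fun m hm hlt => absurd hlt (htiny m hm).not_gt
      _ ≤ _ := by
          rw [mul_comm]
          gcongr
          rw [hK]; linarith

/-! ### Elimination of a neighbourhood of parameters -/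

lemma eventually_rpow_add_le {d ε : ℝ} (hd : d < 1) (hε : 0 < ε) (a : ℝ) :
    ∀ᶠ n : ℕ in atTop, (n : ℝ) ^ d + a ≤ ε * n := by
  have h1 : Tendsto (fun n : ℕ => (n : ℝ) ^ (-(1 - d))) atTop (𝓝 0) :=
    (tendsto_rpow_neg_atTop (by linarith)).comp tendsto_natCast_atTop_atTop
  have h2 : Tendsto (fun n : ℕ => ε / 2 * (n : ℝ)) atTop atTop :=
    tendsto_natCast_atTop_atTop.const_mul_atTop (by positivity)
  filter_upwards [h1.eventually (ge_mem_nhds (half_pos hε)), h2.eventually_ge_atTop a,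
    eventually_gt_atTop 0] with n hn1 hn2 hn3
  have hn : (0:ℝ) < n := by exact_mod_cast hn3
  have : (n:ℝ) ^ d = (n:ℝ) ^ (-(1 - d)) * n := by
    rw [← Real.rpow_add_one hn.ne']; congr 1; ring
  rw [this]
  nlinarith

lemma eventually_mul_exp_neg_le (D : ℝ) {a η : ℝ} (ha : 0 < a) (hη : 0 < η) :
    ∀ᶠ n : ℕ in atTop, D * Real.exp (-a * n) ≤ η := by
  have h2 : Tendsto (fun n : ℕ => -a * (n : ℝ)) atTop atBot :=
    tendsto_natCast_atTop_atTop.const_mul_atTop_of_neg (by linarith)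
  have h3 : Tendsto (fun n : ℕ => D * Real.exp (-a * n)) atTop (𝓝 0) := by
    simpa using (Real.tendsto_exp_atBot.comp h2).const_mul D
  exact h3.eventually (ge_mem_nhds hη)

/-- The constants of the brackets can be chosen so that all brackets have affinity less than `1`. -/
lemma exists_affinity_bracket_le {f g : ℝ → ENNReal} (hf : Measurable f) (hg : Measurable g)
    (hgf : affinity f g < 1) (hf1 : affinity f (fun _ => 1) ≠ ⊤) {F : ℝ}
    (hfF : ∀ x, f x ≤ ENNReal.ofReal F) (hC : 0 ≤ C) (hβ : 2 < β) :
    ∃ ε > 0, ∃ η > 0, ∃ k₀ : ℕ, ∀ b : Fin M → ℕ × ℤ, (∀ m, k₀ ≤ (b m).1) →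
      affinity f (bracket C β g η b) ≤ ENNReal.ofReal (Real.exp (-(2 * ε))) := by
  obtain ⟨D, hD, hgrid⟩ := exists_affinity_gridBracket_le hC hβ hfF
  set a := (affinity f g).toReal with ha
  set J := (affinity f fun _ => 1).toReal with hJ
  have hJ0 : 0 ≤ J := ENNReal.toReal_nonneg
  have ha0 : 0 ≤ a := ENNReal.toReal_nonneg
  have hae : affinity f g = ENNReal.ofReal a := (ENNReal.ofReal_toReal hgf.ne_top).symm
  have ha1 : a < 1 := by
    rw [hae] at hgf
    simpa using hgf
  set γ := (1 - a) / 3 with hγ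
  have hγ0 : 0 < γ := by rw [hγ]; linarith
  have hγ1 : γ < 1 := by rw [hγ]; linarith
  obtain ⟨k₀, hk₀⟩ := exists_nat_ge ((M * D / γ) ^ 2)
  refine ⟨-Real.log (1 - γ) / 2, ?_, (γ / (J + 1)) ^ 2, by positivity, k₀, fun b hb => ?_⟩
  · have := Real.log_neg (by linarith : (0:ℝ) < 1 - γ) (by linarith)
    linarith
  have hexp : Real.exp (-(2 * (-Real.log (1 - γ) / 2))) = 1 - γ := by
    rw [show -(2 * (-Real.log (1 - γ) / 2)) = Real.log (1 - γ) by ring,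
      Real.exp_log (by linarith)]
  rw [hexp]
  refine (affinity_bracket_le hf hg hD (by positivity : (0:ℝ) < k₀ + 1) hgrid
    (fun m => by exact_mod_cast hb m)).trans ?_
  have h1 : affinity f (fun _ => ENNReal.ofReal ((γ / (J + 1)) ^ 2)) ≤ ENNReal.ofReal γ := by
    rw [affinity_const hf, ENNReal.ofReal_rpow_of_nonneg (by positivity) (by norm_num),
      ← Real.sqrt_eq_rpow, Real.sqrt_sq (by positivity), ← ENNReal.ofReal_toReal hf1,
      ← ENNReal.ofReal_mul (by positivity)]
    apply ENNReal.ofReal_le_ofReal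
    rw [← hJ, div_mul_eq_mul_div, div_le_iff₀ (by positivity)]
    nlinarith
  have h2 : M * (D / √((k₀:ℝ) + 1)) ≤ γ := by
    rw [mul_div_assoc', div_le_iff₀ (by positivity), ← div_le_iff₀' hγ0]
    apply Real.le_sqrt_of_sq_le
    linarith
  rw [hae]
  calc _ ≤ ENNReal.ofReal a + ENNReal.ofReal γ + ENNReal.ofReal γ := by
        gcongr
    _ = ENNReal.ofReal (1 - γ) := by
        rw [← ENNReal.ofReal_add ha0 hγ0.le, ← ENNReal.ofReal_add (by positivity) hγ0.le]
        congr 1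
        rw [hγ]; ring

/-- Almost surely, the parameters whose density is dominated, up to components of small scale, by a
function of affinity less than `1` are eventually worse than `θ₀`. -/
theorem exists_ae_eventually_penLikelihood_lt (hφ : ∀ m, IsProbDensity (φ m))
    {θ₀ : Vec M} (hθ₀ : θ₀ ∈ paramSpace M) (htail : TailBound φ)
    (rbar : ℕ → ℝ → ℝ) (dt b₀ : ℝ) (hdt₁ : dt < 1) (hb₀ : 0 < b₀)
    (hbound : RewardBound M rbar dt) (hlower : RewardLowerBound φ θ₀ rbar)
    (hsmall : ScalesEquallySmall M rbar dt b₀)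
    {Ω : Type*} [MeasurableSpace Ω] (P : Measure Ω) [IsProbabilityMeasure P]
    (X : ℕ → Ω → ℝ) (hX : IsSample P X (mixDensity φ θ₀))
    {c : ℝ} (hc₀ : 0 < c) {g : ℝ → ENNReal} (hg : Measurable g)
    (hgaff : affinity (fun x => ENNReal.ofReal (mixDensity φ θ₀ x)) g < 1) (A : Finset (Fin M)) :
    ∃ κ > 0, ∀ᵐ ω ∂P, ∀ᶠ n in atTop, ∀ θ ∈ paramSpace M,
      (∀ x, ENNReal.ofReal (mixDensity φ θ x) ≤
        g x + ∑ m ∈ A, ENNReal.ofReal (component φ θ m x)) →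
      (∀ m ∈ A, scale θ m < κ) →
      penLikelihood φ rbar n (fun i => X i ω) θ < c * penLikelihood φ rbar n (fun i => X i ω) θ₀ := by
  obtain ⟨C, β, hC1, hβ, henv⟩ := htail.exists_envelope
  have hC : 0 ≤ C := by linarith
  obtain ⟨F, hF0, hF⟩ := exists_mixDensity_le henv hC (by linarith) hθ₀
  obtain ⟨R, ρ, δ, hρ, hδ, hrb⟩ := hbound
  obtain ⟨r₀, hr₀, N, hN⟩ := hlower
  obtain ⟨d, c₀, Δ, hdtd, hd1, hc0, hΔ, hsc⟩ := hsmall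
  have hgm : Measurable (mixDensity φ θ₀) := measurable_mixDensity hφ θ₀
  set f : ℝ → ENNReal := fun x => ENNReal.ofReal (mixDensity φ θ₀ x) with hf
  have hfm : Measurable f := by fun_prop
  have hFb : ∀ x, mixDensity φ θ₀ x ≤ F := fun x => by
    refine (hF x).trans (mul_le_of_le_one_right hF0 ?_)
    exact Real.rpow_le_one_of_one_le_of_nonpos (by simp) (by linarith)
  have hf1 : affinity f (fun _ => 1) ≠ ⊤ :=
    affinity_one_ne_top F β hF0 hβ fun x => ENNReal.ofReal_le_ofReal (hF x)
  obtain ⟨εp, hεp, η, hη, k₀, hbr⟩ := exists_affinity_bracket_le (M := M) (C := C) hfm hg hgaff hf1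
    (fun x => ENNReal.ofReal_le_ofReal (hFb x)) hC hβ
  -- The brackets at sample size `n` number about `exp (3 * M * ε * n)`.
  set ε := εp / (3 * M + 3) with hε
  have hε0 : 0 < ε := by positivity
  have hεM : 3 * M * ε ≤ εp := by
    rw [hε, mul_div_assoc', div_le_iff₀ (by positivity)]
    nlinarith
  set ε₂ := Δ * ε / 8 with hε₂
  have hε₂0 : 0 < ε₂ := by positivity
  set q : ℕ → ℕ := fun n => ⌈Real.exp (ε * n)⌉₊ with hq
  have hQ1 : ∀ n : ℕ, 1 ≤ Real.exp (ε * n) := fun n => Real.one_le_exp (by positivity)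
  have hQq : ∀ n : ℕ, Real.exp (ε * n) ≤ q n := fun n => Nat.le_ceil _
  have hq1 : ∀ n, 1 ≤ q n := fun n => by
    have := (hQ1 n).trans (hQq n)
    exact_mod_cast this
  have hcard : ∀ n : ℕ, ((bracketLabels M k₀ (q n)).card : ℝ) ≤ 176 ^ M * Real.exp (εp * n) := by
    intro n
    have h1 : ((bracketLabels M k₀ (q n)).card : ℝ) ≤ (22 * (q n : ℝ) ^ 3) ^ M := by
      exact_mod_cast card_bracketLabels_le M k₀ (hq1 n)
    have h2 : (q n : ℝ) ≤ 2 * Real.exp (ε * n) := by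
      have := Nat.ceil_lt_add_one (Real.exp_pos (ε * n)).le
      linarith [hQ1 n]
    calc _ ≤ _ := h1
      _ ≤ (22 * (2 * Real.exp (ε * n)) ^ 3) ^ M := by gcongr
      _ = 176 ^ M * Real.exp (3 * M * ε * n) := by
          rw [show 22 * (2 * Real.exp (ε * n)) ^ 3 = 176 * Real.exp (ε * n) ^ 3 by ring, mul_pow,
            ← pow_mul, ← Real.exp_nat_mul]
          congr 2
          push_cast; ring
      _ ≤ _ := by gcongr
  set K := max R 0 + ρ + max 1 (C / η) ^ M with hK
  have hcr : 0 < c * r₀ := by positivity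
  have hev := hX.ae_eventually_prod_lt hgm (fun n => bracketLabels M k₀ (q n))
    (fun b => bracket C β g η b) (fun b => measurable_bracket hg C β η b) hεp
    (Eventually.of_forall hcard)
    (fun n b hb => hbr b fun m => by
      have := Fintype.mem_piFinset.1 hb m
      simp only [Finset.mem_product, Finset.mem_Icc] at this
      exact this.1.1)
    (K / (c * r₀))
  have hsepε := hX.ae_eventually_separated hFb (by positivity : 0 < ε / 4)
  have hsepε₂ := hX.ae_eventually_separated hFb hε₂0
  have hrange := hX.ae_eventually_abs_le hgm hβ hF0 hF hε0
  refine ⟨1 / (k₀ + 1), by positivity, ?_⟩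
  filter_upwards [hev, hsepε, hsepε₂, hrange] with ω hω hs₁ hs₂ hra
  filter_upwards [hω, hs₁, hs₂, hra, eventually_ge_atTop N, eventually_ge_atTop 1,
    eventually_ge_atTop (6 * M),
    eventually_mul_exp_neg_le k₀ hε0 one_pos,
    eventually_mul_exp_neg_le C (half_pos hε0) (by positivity : 0 < η / (M + 1)),
    eventually_mul_exp_neg_le (Real.exp 1 * C) hε₂0 hη,
    eventually_rpow_add_le hd1 hε0 (-Real.log c₀),
    eventually_rpow_add_le hdt₁ (by positivity : 0 < Δ * ε / 2) (-Real.log b₀),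
    eventually_rpow_add_le hdt₁ one_pos 0] with
    n hω hs₁ hs₂ hra hnN hn1 hnM hk₀ hη₁ hη₂ hcn hbn hdtn θ hθ hdom hsm
  have hn0 : (0:ℝ) ≤ n := Nat.cast_nonneg n
  obtain ⟨hrew0, hrew1⟩ := hrb n hn1 _ (scaleRatio_mem hθ)
  have hy := scaleRatio_mem hθ
  have hinv : (Real.exp (ε * n))⁻¹ = Real.exp (-ε * n) := by rw [← Real.exp_neg, neg_mul]
  obtain ⟨b, hb, hpen⟩ := exists_bracket_penLikelihood_le (k₀ := k₀) (q := q n)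
    (Q := Real.exp (ε * n)) (r := Real.exp (-(ε / 4) * n)) (η := η) (rbar := rbar) (n := n)
    (R := max R 0) (ρ := ρ) (x := fun i => X i ω) (s := Real.exp (-ε₂ * n))
    hφ henv hC hβ.le hθ hdom
    (by
      have h := hQq n
      rw [neg_mul, Real.exp_neg, ← div_eq_mul_inv, div_le_one (Real.exp_pos _)] at hk₀
      exact_mod_cast hk₀.trans h)
    hsm (hQ1 n) (hQq n) (Real.exp_pos _) hη
    (by
      refine le_trans (le_of_eq ?_) hη₁
      rw [hinv, ← Real.exp_nat_mul, mul_div_assoc, ← Real.exp_sub]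
      congr 2
      push_cast; ring)
    (by
      refine le_trans ?_ hη₁
      rw [← Real.exp_nat_mul, div_eq_mul_inv, ← Real.exp_neg]
      gcongr
      push_cast; nlinarith [mul_nonneg hε0.le hn0])
    hrew0 (hrew1.trans ((min_le_left _ _).trans (le_max_left _ _))) hρ.le
    (by
      refine (hrew1.trans (min_le_right _ _)).trans ?_
      gcongr
      · exact mul_nonneg hρ.le (pow_nonneg hy.1.le _)
      · rw [← Real.rpow_natCast]
        exact Real.rpow_le_rpow_of_exponent_ge hy.1 hy.2 (by linarith)
      · linarith)
    hnM hra hs₁ (Real.exp_pos _).le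
    (by rw [Real.exp_le_one_iff]; nlinarith [mul_nonneg hε₂0.le hn0])
    hs₂ hη₂
    (by
      intro hlt hrew
      rw [hinv] at hlt
      have hlt2 : minScale θ < c₀ * Real.exp (-(n:ℝ) ^ d) := by
        refine hlt.trans_le ?_
        rw [← Real.exp_log hc0, ← Real.exp_add]
        gcongr
        linarith
      refine (hsc n hn1 θ hθ hlt2 hrew).le.trans ?_
      rw [div_le_iff₀ (by positivity)]
      calc minScale θ ^ Δ ≤ Real.exp (-ε * n) ^ Δ := by
            gcongr; exact (minScale_pos hθ).le
        _ = Real.exp (-ε * n * Δ) := by rw [← Real.exp_mul]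
        _ ≤ Real.exp (-ε₂ * n) ^ 4 * (b₀ * Real.exp (-(n:ℝ) ^ dt)) := by
            rw [← Real.exp_nat_mul, ← Real.exp_log hb₀, ← Real.exp_add, ← Real.exp_add]
            gcongr
            rw [hε₂]
            push_cast
            linarith)
  have hlt := hω b hb
  have h0 : 0 ≤ ∏ i ∈ Finset.range n, mixDensity φ θ₀ (X i ω) :=
    Finset.prod_nonneg fun i _ => mixDensity_nonneg hφ hθ₀ _
  have hθ₀mem : θ₀ ∈ sameDensity φ θ₀ := ⟨hθ₀, EventuallyEq.rfl⟩
  refine (ENNReal.ofReal_lt_ofReal_iff_of_nonneg ?_).1 (hpen.trans_lt ?_)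
  · exact mul_nonneg (Finset.prod_nonneg fun i _ => mixDensity_nonneg hφ hθ _) hrew0
  calc ENNReal.ofReal K * ∏ i ∈ Finset.range n, bracket C β g η b (X i ω)
      = ENNReal.ofReal (c * r₀) * (ENNReal.ofReal (K / (c * r₀)) *
          ∏ i ∈ Finset.range n, bracket C β g η b (X i ω)) := by
        rw [← mul_assoc, ← ENNReal.ofReal_mul hcr.le, mul_div_cancel₀ _ hcr.ne']
    _ < ENNReal.ofReal (c * r₀) * ∏ i ∈ Finset.range n, f (X i ω) := by
        exact (ENNReal.mul_lt_mul_iff_right (by simpa using hcr) ENNReal.ofReal_ne_top).2 hlt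
    _ = ENNReal.ofReal (c * ((∏ i ∈ Finset.range n, mixDensity φ θ₀ (X i ω)) * r₀)) := by
        rw [← ENNReal.ofReal_prod_of_nonneg fun i _ => mixDensity_nonneg hφ hθ₀ _,
          ← ENNReal.ofReal_mul hcr.le]
        congr 1; ring
    _ ≤ _ := by
        apply ENNReal.ofReal_le_ofReal
        unfold penLikelihood
        gcongr
        exact hN n hnN θ₀ hθ₀mem

end

/-! ### Limits of components along an ultrafilter -/

section Ultra

variable {M : ℕ} {φ : Fin M → ℝ → ℝ} {C β : ℝ}

lemma exists_affinity_const_le {f : ℝ → ENNReal} (hf : Measurable f)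
    (hf1 : affinity f (fun _ => 1) ≠ ⊤) {ε : ENNReal} (hε : ε ≠ 0) :
    ∃ a : ℝ, 0 < a ∧ affinity f (fun _ => ENNReal.ofReal a) ≤ ε := by
  have h : Tendsto (fun a : ℝ => affinity f (fun _ => ENNReal.ofReal a)) (𝓝[>] 0) (𝓝 0) := by
    have h1 : Tendsto (fun a : ℝ => ENNReal.ofReal a ^ (1 / 2 : ℝ)) (𝓝[>] 0) (𝓝 0) := by
      have : Continuous fun a : ℝ => ENNReal.ofReal a ^ (1 / 2 : ℝ) :=
        (ENNReal.continuous_rpow_const).comp ENNReal.continuous_ofReal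
      simpa using (this.tendsto 0).mono_left nhdsWithin_le_nhds
    have h2 := ENNReal.Tendsto.mul_const h1 (Or.inr hf1)
    rw [zero_mul] at h2
    exact h2.congr fun a => (affinity_const hf _).symm
  obtain ⟨a, ha, ha0⟩ := ((h.eventually (ge_mem_nhds (pos_iff_ne_zero.2 hε))).and
    self_mem_nhdsWithin).exists
  exact ⟨a, ha0, ha⟩

lemma exists_tendsto_of_bounded {α : Type*} (U : Ultrafilter α) (h : α → ℝ) {a b : ℝ}
    (hab : ∀ᶠ t in (U : Filter α), h t ∈ Set.Icc a b) :
    ∃ y ∈ Set.Icc a b, Tendsto h U (𝓝 y) :=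
  isCompact_Icc.ultrafilter_le_nhds (U.map h) (le_principal_iff.2 (mem_map.2 hab))

/-- The bound of a component with scale in `[κ, B]` whose location exceeds `n` in absolute value. -/
noncomputable def remoteBound (C β κ B : ℝ) (n : ℕ) (x : ℝ) : ENNReal :=
  ENNReal.ofReal (C / κ * (1 + max (n - |x|) 0 / B) ^ (-β))

lemma measurable_remoteBound (C β κ B : ℝ) (n : ℕ) : Measurable (remoteBound C β κ B n) := by
  unfold remoteBound
  fun_prop

lemma component_le_remoteBound (henv : HasEnvelope φ C β) (hC : 0 ≤ C) (hβ : 0 ≤ β) {θ : Vec M}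
    {m : Fin M} {κ B : ℝ} {n : ℕ} (hκ : 0 < κ) (hs : κ ≤ scale θ m) (hB : scale θ m ≤ B)
    (hn : n ≤ |loc θ m|) (x : ℝ) :
    ENNReal.ofReal (component φ θ m x) ≤ remoteBound C β κ B n x := by
  have hs0 : 0 < scale θ m := hκ.trans_le hs
  apply ENNReal.ofReal_le_ofReal
  refine (component_le_envelope henv hs0 x).trans ?_
  gcongr ?_ * ?_
  · gcongr
  · apply Real.rpow_le_rpow_of_nonpos _ _ (by linarith)
    · have : 0 ≤ max ((n:ℝ) - |x|) 0 := le_max_right _ _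
      have hB0 : 0 < B := hs0.trans_le hB
      positivity
    · gcongr
      refine max_le ?_ (abs_nonneg _)
      have := abs_sub_abs_le_abs_sub (loc θ m) x
      rw [abs_sub_comm] at this
      linarith

lemma tendsto_affinity_remoteBound {f : ℝ → ENNReal} (hf : Measurable f) (hft : ∀ x, f x ≠ ⊤)
    (hf1 : affinity f (fun _ => 1) ≠ ⊤) (hC : 0 ≤ C) (hβ : 0 < β) {κ B : ℝ} (hκ : 0 < κ)
    (hB : 0 < B) : Tendsto (fun n => affinity f (remoteBound C β κ B n)) atTop (𝓝 0) := by
  have hbound : affinity f (fun _ => ENNReal.ofReal (C / κ)) ≠ ⊤ := by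
    rw [affinity_const hf]
    exact ENNReal.mul_ne_top (ENNReal.rpow_ne_top_of_nonneg (by norm_num) ENNReal.ofReal_ne_top) hf1
  have key := tendsto_lintegral_of_dominated_convergence' (μ := (volume : Measure ℝ))
    (F := fun n x => remoteBound C β κ B n x ^ (1 / 2 : ℝ) * f x ^ (1 / 2 : ℝ)) (f := fun _ => 0)
    (fun x => ENNReal.ofReal (C / κ) ^ (1 / 2 : ℝ) * f x ^ (1 / 2 : ℝ))
    (fun n => by
      have := measurable_remoteBound C β κ B n
      fun_prop)
    (fun n => ae_of_all _ fun x => by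
      dsimp only
      gcongr
      apply ENNReal.ofReal_le_ofReal
      refine mul_le_of_le_one_right (by positivity) ?_
      have : 0 ≤ max ((n:ℝ) - |x|) 0 := le_max_right _ _
      exact Real.rpow_le_one_of_one_le_of_nonpos (by simp; positivity) (by linarith))
    hbound
    (ae_of_all _ fun x => by
      have h1 : Tendsto (fun n : ℕ => 1 + max ((n:ℝ) - |x|) 0 / B) atTop atTop := by
        apply tendsto_atTop_add_const_left
        apply Tendsto.atTop_div_const hB
        refine tendsto_atTop_mono (fun n => le_max_left _ _) ?_
        exact tendsto_atTop_add_const_right _ _ tendsto_natCast_atTop_atTop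
      have h2 := ((tendsto_rpow_neg_atTop hβ).comp h1).const_mul (C / κ)
      rw [mul_zero] at h2
      have h3 := ((ENNReal.continuous_rpow_const (y := 1 / 2)).comp
        ENNReal.continuous_ofReal).continuousAt.tendsto.comp h2
      have h4 := ENNReal.Tendsto.mul_const (b := f x ^ (1 / 2 : ℝ)) h3
        (Or.inr (ENNReal.rpow_ne_top_of_nonneg (by norm_num) (hft x)))
      simpa [remoteBound, Function.comp_def] using h4)
  simpa [affinity] using key

/-- Along an ultrafilter of parameters, each component converges, or its scale tends to `0`, or it
flattens out or moves to infinity and is dominated by functions of arbitrarily small affinity. -/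
lemma component_trichotomy {f : ℝ → ENNReal} (hf : Measurable f) (hft : ∀ x, f x ≠ ⊤)
    (hf1 : affinity f (fun _ => 1) ≠ ⊤) (henv : HasEnvelope φ C β) (hC : 0 < C) (hβ : 0 < β)
    (U : Ultrafilter (Vec M)) (m : Fin M) :
    (∃ μ σ : ℝ, 0 < σ ∧ Tendsto (fun θ => loc θ m) U (𝓝 μ) ∧
      Tendsto (fun θ => scale θ m) U (𝓝 σ)) ∨
    (∀ κ > 0, ∀ᶠ θ in (U : Filter (Vec M)), scale θ m < κ) ∨
    ∀ ε : ENNReal, ε ≠ 0 → ∃ e : ℝ → ENNReal, Measurable e ∧ affinity f e ≤ ε ∧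
      ∀ᶠ θ in (U : Filter (Vec M)), ∀ x, ENNReal.ofReal (component φ θ m x) ≤ e x := by
  by_cases hsmall : ∀ κ > 0, ∀ᶠ θ in (U : Filter (Vec M)), scale θ m < κ
  · exact Or.inr (Or.inl hsmall)
  push Not at hsmall
  obtain ⟨κ, hκ, hκU⟩ := hsmall
  by_cases hlarge : ∀ B : ℝ, ∀ᶠ θ in (U : Filter (Vec M)), B < scale θ m
  · refine Or.inr (Or.inr fun ε hε => ?_)
    obtain ⟨a, ha, haε⟩ := exists_affinity_const_le hf hf1 hε
    refine ⟨fun _ => ENNReal.ofReal a, measurable_const, haε, ?_⟩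
    filter_upwards [hlarge (C / a)] with θ hθ x
    have hs : 0 < scale θ m := lt_trans (by positivity) hθ
    refine ENNReal.ofReal_le_ofReal ((component_le_div_scale henv hC.le hβ.le hs x).trans ?_)
    rw [div_lt_iff₀ ha] at hθ
    rw [div_le_iff₀ hs]
    linarith
  push Not at hlarge
  obtain ⟨B, hB⟩ := hlarge
  by_cases hremote : ∀ n : ℕ, ∀ᶠ θ in (U : Filter (Vec M)), n < |loc θ m|
  · refine Or.inr (Or.inr fun ε hε => ?_)
    have hB0 : 0 < B := by
      obtain ⟨θ, h1, h2⟩ := (hκU.and hB).exists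
      exact hκ.trans_le (h1.trans h2)
    obtain ⟨n, hn⟩ := ((tendsto_affinity_remoteBound hf hft hf1 hC.le hβ hκ hB0).eventually
      (ge_mem_nhds (pos_iff_ne_zero.2 hε))).exists
    refine ⟨_, measurable_remoteBound C β κ B n, hn, ?_⟩
    filter_upwards [hκU, hB, hremote n] with θ h1 h2 h3 x
    exact component_le_remoteBound henv hC.le hβ.le hκ h1 h2 h3.le x
  push Not at hremote
  obtain ⟨n, hn⟩ := hremote
  left
  obtain ⟨μ, -, hμ⟩ := exists_tendsto_of_bounded U (fun θ => loc θ m) (a := -n) (b := n)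
    (hn.mono fun θ h => abs_le.1 h)
  obtain ⟨σ, hσ, hσt⟩ := exists_tendsto_of_bounded U (fun θ => scale θ m) (a := κ) (b := B)
    (hκU.and hB)
  exact ⟨μ, σ, hκ.trans_le hσ.1, hμ, hσt⟩

/-! ### Local suprema of the density -/

lemma abs_apply_sub_le_dist (θ θ' : Vec M) (p : Fin 3 × Fin M) : |θ p - θ' p| ≤ dist θ θ' := by
  rw [dist_eq_norm]
  simpa using PiLp.norm_apply_le (θ - θ') p

lemma half_minScale_le_scale {θ θ' : Vec M} (h : θ' ∈ Metric.closedBall θ (minScale θ / 2))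
    (m : Fin M) : minScale θ / 2 ≤ scale θ' m := by
  have h1 := (abs_apply_sub_le_dist θ' θ (2, m)).trans (Metric.mem_closedBall.1 h)
  have h2 := minScale_le θ m
  unfold scale at h2 ⊢
  linarith [(abs_le.1 h1).1]

lemma isCompact_paramSpace_inter_closedBall {θ : Vec M} (hθ : θ ∈ paramSpace M) :
    IsCompact (paramSpace M ∩ Metric.closedBall θ (minScale θ / 2)) := by
  have hmin := minScale_pos hθ
  have e : paramSpace M ∩ Metric.closedBall θ (minScale θ / 2) =
      Metric.closedBall θ (minScale θ / 2) ∩ {θ' | (∀ m, 0 ≤ weight θ' m) ∧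
        ∑ m, weight θ' m = 1 ∧ ∀ m, minScale θ / 2 ≤ scale θ' m} := by
    ext θ'
    constructor
    · rintro ⟨h1, h2⟩
      exact ⟨h2, h1.1, h1.2.1, half_minScale_le_scale h2⟩
    · rintro ⟨h1, h2⟩
      exact ⟨⟨h2.1, h2.2.1, fun m => lt_of_lt_of_le (by positivity) (h2.2.2 m)⟩, h1⟩
  rw [e]
  refine (isCompact_closedBall _ _).inter_right ?_
  have hw : ∀ m, Continuous fun θ' : Vec M => weight θ' m := fun m => by unfold weight; fun_prop
  have hs : ∀ m, Continuous fun θ' : Vec M => scale θ' m := fun m => by unfold scale; fun_prop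
  refine IsClosed.inter ?_ (IsClosed.inter ?_ ?_)
  · change IsClosed {θ' : Vec M | ∀ m, 0 ≤ weight θ' m}
    rw [Set.ofPred_forall]
    exact isClosed_iInter fun m => isClosed_le continuous_const (hw m)
  · exact isClosed_eq (continuous_finsetSum _ fun m _ => hw m) continuous_const
  · change IsClosed {θ' : Vec M | ∀ m, minScale θ / 2 ≤ scale θ' m}
    rw [Set.ofPred_forall]
    exact isClosed_iInter fun m => isClosed_le continuous_const (hs m)

/-- The affinity of the local supremum around `θ` tends to that of `f(·; θ)` as the radius tends to
`0`, by dominated convergence. -/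
lemma exists_affinity_supDensity_lt {f : ℝ → ENNReal} (hf : Measurable f) (hft : ∀ x, f x ≠ ⊤)
    (hf1 : affinity f (fun _ => 1) ≠ ⊤) (henv : HasEnvelope φ C β)
    (hC : 0 ≤ C) (hβ : 0 ≤ β) (hmeas : SupDensityMeasurable φ) (hcont : AEContinuousInParam φ)
    {θ : Vec M} (hθ : θ ∈ paramSpace M) {a : ENNReal}
    (ha : affinity f (fun x => ENNReal.ofReal (mixDensity φ θ x)) < a) :
    ∃ ρ > 0, AEMeasurable (supDensity φ θ ρ) volume ∧ affinity f (supDensity φ θ ρ) < a := by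
  have hmin := minScale_pos hθ
  obtain ⟨δ, hδ, hδm⟩ := mem_nhdsGT_iff_exists_Ioo_subset.1 (hmeas θ hθ)
  have hδ0 : 0 < δ := hδ
  set ε := min (δ / 2) (minScale θ / 2) with hε
  have hε0 : 0 < ε := by positivity
  set r : ℕ → ℝ := fun k => ε / (k + 1) with hr
  have hr0 : ∀ k, 0 < r k := fun k => by positivity
  have hrε : ∀ k, r k ≤ ε := fun k => div_le_self hε0.le (by simp)
  have hrmin : ∀ k, r k ≤ minScale θ / 2 := fun k => (hrε k).trans (min_le_right _ _)
  have hr_anti : Antitone r := fun i j hij => by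
    simp only [hr]
    gcongr
  have hr_lim : Tendsto r atTop (𝓝 0) :=
    tendsto_const_nhds.div_atTop
      (tendsto_atTop_add_const_right _ _ tendsto_natCast_atTop_atTop)
  have hrm : ∀ k, AEMeasurable (supDensity φ θ (r k)) volume := fun k =>
    hδm ⟨hr0 k, by
      have h1 := (hrε k).trans (min_le_left _ _)
      linarith⟩
  have hbound : affinity f (fun _ => ENNReal.ofReal (C / (minScale θ / 2))) ≠ ⊤ := by
    rw [affinity_const hf]
    exact ENNReal.mul_ne_top (ENNReal.rpow_ne_top_of_nonneg (by norm_num) ENNReal.ofReal_ne_top) hf1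
  have hdom : ∀ k x, supDensity φ θ (r k) x ≤ ENNReal.ofReal (C / (minScale θ / 2)) := by
    intro k x
    refine iSup₂_le fun θ' hθ' => ENNReal.ofReal_le_ofReal ?_
    refine mixDensity_le_of_component_le hθ'.1 fun m => ?_
    refine (component_le_div_scale henv hC hβ (hθ'.1.2.2 m) x).trans ?_
    gcongr
    exact half_minScale_le_scale (Metric.closedBall_subset_closedBall (hrmin k) hθ'.2) m
  have hθΓ : θ ∈ paramSpace M ∩ Metric.closedBall θ (minScale θ / 2) :=
    ⟨hθ, Metric.mem_closedBall_self (by positivity)⟩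
  have hlim : ∀ᵐ x ∂(volume : Measure ℝ), Tendsto (fun k => supDensity φ θ (r k) x) atTop
      (𝓝 (ENNReal.ofReal (mixDensity φ θ x))) := by
    filter_upwards [hcont _ Set.inter_subset_left (isCompact_paramSpace_inter_closedBall hθ) θ
      hθΓ] with x hx
    refine tendsto_order.2 ⟨fun b hb => Eventually.of_forall fun k => hb.trans_le ?_, fun b hb => ?_⟩
    · exact le_iSup₂_of_le θ ⟨hθ, Metric.mem_closedBall_self (hr0 k).le⟩ le_rfl
    · -- Otherwise some parameters tending to `θ` have densities at least `b'` at `x`.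
      by_contra hcon
      obtain ⟨b', hb1, hb2⟩ := exists_between hb
      have hch : ∀ k, ∃ θ' ∈ paramSpace M ∩ Metric.closedBall θ (r k),
          b' < ENNReal.ofReal (mixDensity φ θ' x) := by
        intro k
        rw [not_eventually] at hcon
        obtain ⟨j, hkj, hj⟩ := (frequently_atTop.1 hcon) k
        have hlt : b' < supDensity φ θ (r j) x := hb2.trans_le (not_lt.1 hj)
        simp only [supDensity, lt_iSup_iff] at hlt
        obtain ⟨θ', hθ', h⟩ := hlt
        exact ⟨θ', ⟨hθ'.1, Metric.closedBall_subset_closedBall (hr_anti hkj) hθ'.2⟩, h⟩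
      choose u hu hub using hch
      have hut : Tendsto u atTop (𝓝 θ) :=
        tendsto_iff_dist_tendsto_zero.2
          (squeeze_zero (fun _ => dist_nonneg) (fun k => Metric.mem_closedBall.1 (hu k).2) hr_lim)
      have := hx u (fun j => ⟨(hu j).1, Metric.closedBall_subset_closedBall (hrmin j) (hu j).2⟩) hut
      have h2 := (ENNReal.continuous_ofReal.tendsto _).comp this
      obtain ⟨k, hk⟩ := (h2.eventually (gt_mem_nhds hb1)).exists
      exact absurd (hub k) (not_lt.2 hk.le)
  have key := tendsto_lintegral_of_dominated_convergence' (μ := (volume : Measure ℝ))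
    (F := fun k x => supDensity φ θ (r k) x ^ (1 / 2 : ℝ) * f x ^ (1 / 2 : ℝ))
    (f := fun x => ENNReal.ofReal (mixDensity φ θ x) ^ (1 / 2 : ℝ) * f x ^ (1 / 2 : ℝ))
    (fun x => ENNReal.ofReal (C / (minScale θ / 2)) ^ (1 / 2 : ℝ) * f x ^ (1 / 2 : ℝ))
    (fun k => by
      have := hrm k
      fun_prop)
    (fun k => ae_of_all _ fun x => by
      have := hdom k x
      dsimp only
      gcongr)
    hbound
    (hlim.mono fun x hx => by
      have h3 := (ENNReal.continuous_rpow_const (y := 1 / 2)).continuousAt.tendsto.comp hx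
      exact ENNReal.Tendsto.mul_const h3
        (Or.inr (ENNReal.rpow_ne_top_of_nonneg (by norm_num) (hft x))))
  obtain ⟨k, hk⟩ := (key.eventually (gt_mem_nhds ha)).exists
  exact ⟨r k, hr0 k, hrm k, hk⟩

/-! ### Integrals of the densities -/

lemma integrable_component (hφ : ∀ m, IsProbDensity (φ m)) {θ : Vec M} {m : Fin M}
    (hs : 0 < scale θ m) : Integrable (component φ θ m) := by
  have hi : Integrable (φ m) := by
    by_contra h
    have := (hφ m).integral_eq_one
    rw [integral_undef h] at this
    exact zero_ne_one this
  exact ((hi.comp_div hs.ne').comp_sub_right (loc θ m)).const_mul _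

lemma integral_component (hφ : ∀ m, IsProbDensity (φ m)) {θ : Vec M} {m : Fin M}
    (hs : 0 < scale θ m) : ∫ x, component φ θ m x = 1 := by
  unfold component
  rw [integral_const_mul, integral_sub_right_eq_self (fun x => φ m (x / scale θ m)),
    Measure.integral_comp_div, (hφ m).integral_eq_one, abs_of_pos hs, smul_eq_mul]
  field_simp

lemma integral_sum_weight_mul_component (hφ : ∀ m, IsProbDensity (φ m)) {θ : Vec M}
    (hs : ∀ m, 0 < scale θ m) (T : Finset (Fin M)) :
    ∫ x, ∑ m ∈ T, weight θ m * component φ θ m x = ∑ m ∈ T, weight θ m := by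
  rw [integral_finsetSum _ fun m _ => (integrable_component hφ (hs m)).const_mul _]
  refine Finset.sum_congr rfl fun m _ => ?_
  rw [integral_const_mul, integral_component hφ (hs m), mul_one]

end Ultra

/-! ### Limits of mixtures along an ultrafilter -/

section Dichotomy

variable {M : ℕ} {φ : Fin M → ℝ → ℝ} {C β : ℝ}

/-- Reset the components outside `T` to location `0` and scale `B`, and keep all the weights. -/
noncomputable def resetOutside (T : Finset (Fin M)) (B : ℝ) (θ : Vec M) : Vec M :=
  WithLp.toLp 2 fun p => if p.1 = 0 ∨ p.2 ∈ T then θ p else if p.1 = 1 then 0 else B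

section Reset

variable (T : Finset (Fin M)) (B : ℝ) (θ : Vec M) {m : Fin M}

lemma weight_resetOutside (m : Fin M) : weight (resetOutside T B θ) m = weight θ m := by
  simp [weight, resetOutside]

variable {T}

lemma scale_resetOutside_of_notMem (hm : m ∉ T) : scale (resetOutside T B θ) m = B := by
  simp [scale, resetOutside, hm]

lemma scale_resetOutside_of_mem (hm : m ∈ T) : scale (resetOutside T B θ) m = scale θ m := by
  simp [scale, resetOutside, hm]

lemma component_resetOutside_of_mem (hm : m ∈ T) :
    component φ (resetOutside T B θ) m = component φ θ m := by
  funext x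
  simp [component, loc, scale, resetOutside, hm]

variable {B θ}

lemma resetOutside_mem_paramSpace (hB : 0 < B) (hw : ∀ m, 0 ≤ weight θ m)
    (hw1 : ∑ m, weight θ m = 1) (hs : ∀ m ∈ T, 0 < scale θ m) :
    resetOutside T B θ ∈ paramSpace M := by
  refine ⟨fun m => ?_, ?_, fun m => ?_⟩
  · rw [weight_resetOutside]; exact hw m
  · simp only [weight_resetOutside]; exact hw1
  · by_cases hm : m ∈ T
    · rw [scale_resetOutside_of_mem _ _ hm]; exact hs m hm
    · rw [scale_resetOutside_of_notMem _ _ hm]; exact hB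

end Reset

lemma tendsto_vec_of_apply {l : Filter (Vec M)} {h : Vec M → Vec M} {θ : Vec M}
    (H : ∀ p, Tendsto (fun θ' => h θ' p) l (𝓝 (θ p))) : Tendsto h l (𝓝 θ) := by
  have h1 : Tendsto (fun θ' => (h θ').ofLp) l (𝓝 θ.ofLp) := tendsto_pi_nhds.2 H
  exact ((PiLp.continuous_toLp 2 (fun _ : Fin 3 × Fin M => ℝ)).tendsto _).comp h1

/-- An ultrafilter on `Θ` converges to a parameter of the true density, or one of its members
consists of parameters whose densities are dominated, up to components of small scale, by a function
of affinity less than `1` with the true density. -/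
lemma ultrafilter_dichotomy (hφ : ∀ m, IsProbDensity (φ m))
    {θ₀ : Vec M} (hθ₀ : θ₀ ∈ paramSpace M)
    (hmeas : SupDensityMeasurable φ) (hcont : AEContinuousInParam φ) (htail : TailBound φ)
    (hexact : mixDensity φ θ₀ ∉ mixtureClass φ (M - 1))
    (U : Ultrafilter (Vec M)) (hU : ∀ᶠ θ in (U : Filter (Vec M)), θ ∈ paramSpace M) :
    (∃ θ ∈ sameDensity φ θ₀, (U : Filter (Vec M)) ≤ 𝓝 θ) ∨
    ∃ g : ℝ → ENNReal, Measurable g ∧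
      affinity (fun x => ENNReal.ofReal (mixDensity φ θ₀ x)) g < 1 ∧ ∃ A : Finset (Fin M),
        (∀ᶠ θ in (U : Filter (Vec M)), ∀ x, ENNReal.ofReal (mixDensity φ θ x) ≤
          g x + ∑ m ∈ A, ENNReal.ofReal (component φ θ m x)) ∧
        ∀ κ > 0, ∀ᶠ θ in (U : Filter (Vec M)), ∀ m ∈ A, scale θ m < κ := by
  classical
  obtain ⟨C, β, hC1, hβ, henv⟩ := htail.exists_envelope
  have hC : 0 < C := by linarith
  have hβ0 : 0 < β := by linarith
  obtain ⟨F, hF0, hF⟩ := exists_mixDensity_le henv hC.le hβ0.le hθ₀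
  have hgm : Measurable (mixDensity φ θ₀) := measurable_mixDensity hφ θ₀
  set f : ℝ → ENNReal := fun x => ENNReal.ofReal (mixDensity φ θ₀ x) with hf
  have hfm : Measurable f := by fun_prop
  have hft : ∀ x, f x ≠ ⊤ := fun x => ENNReal.ofReal_ne_top
  have hf1 : affinity f (fun _ => 1) ≠ ⊤ :=
    affinity_one_ne_top F β hF0 hβ fun x => ENNReal.ofReal_le_ofReal (hF x)
  have htri := component_trichotomy hfm hft hf1 henv hC hβ0 U
  -- The limits of the weights and of the convergent components form the limit parameter `θL`.
  have hwlim : ∀ m, ∃ y ∈ Set.Icc (0:ℝ) 1, Tendsto (fun θ => weight θ m) U (𝓝 y) := fun m =>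
    exists_tendsto_of_bounded U _ (hU.mono fun θ hθ => ⟨hθ.1 m, weight_le_one hθ m⟩)
  choose α hα hαlim using hwlim
  set T : Finset (Fin M) := Finset.univ.filter fun m => ∃ μ σ : ℝ, 0 < σ ∧
    Tendsto (fun θ => loc θ m) U (𝓝 μ) ∧ Tendsto (fun θ => scale θ m) U (𝓝 σ) with hT
  set A : Finset (Fin M) := Finset.univ.filter fun m => m ∉ T ∧
    ∀ κ > 0, ∀ᶠ θ in (U : Filter (Vec M)), scale θ m < κ with hA
  set E : Finset (Fin M) := Finset.univ.filter fun m => m ∉ T ∧ m ∉ A with hE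
  have hlim : ∀ m, ∃ p : ℝ × ℝ, 0 < p.2 ∧ (m ∈ T →
      Tendsto (fun θ => loc θ m) U (𝓝 p.1) ∧ Tendsto (fun θ => scale θ m) U (𝓝 p.2)) := by
    intro m
    by_cases hm : m ∈ T
    · obtain ⟨μ, σ, h1, h2, h3⟩ := (Finset.mem_filter.1 hm).2
      exact ⟨(μ, σ), h1, fun _ => ⟨h2, h3⟩⟩
    · exact ⟨(0, 1), one_pos, fun h => absurd h hm⟩
  choose p hp0 hp using hlim
  set θL : Vec M := WithLp.toLp 2 fun i =>
    if i.1 = 0 then α i.2 else if i.1 = 1 then (p i.2).1 else (p i.2).2 with hθL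
  have hwL : ∀ m, weight θL m = α m := fun m => by simp [weight, hθL]
  have hsL : ∀ m, scale θL m = (p m).2 := fun m => by simp [scale, hθL]
  have hlL : ∀ m, loc θL m = (p m).1 := fun m => by simp [loc, hθL]
  have hsum : ∑ m, weight θL m = 1 := by
    have h1 : Tendsto (fun θ : Vec M => ∑ m, weight θ m) U (𝓝 (∑ m, weight θL m)) :=
      tendsto_finsetSum _ fun m _ => by rw [hwL]; exact hαlim m
    have h2 : Tendsto (fun θ : Vec M => ∑ m, weight θ m) U (𝓝 1) :=
      tendsto_const_nhds.congr' (hU.mono fun θ hθ => hθ.2.1.symm)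
    exact tendsto_nhds_unique h1 h2
  have hw0 : ∀ m, 0 ≤ weight θL m := fun m => by rw [hwL]; exact (hα m).1
  have hs0 : ∀ m, 0 < scale θL m := fun m => by rw [hsL]; exact hp0 m
  have hLmem : θL ∈ paramSpace M := ⟨hw0, hsum, hs0⟩
  have hcoord : ∀ i : Fin 3 × Fin M, i.1 = 0 ∨ i.2 ∈ T →
      Tendsto (fun θ : Vec M => θ i) U (𝓝 (θL i)) := by
    rintro ⟨i, m⟩ him
    fin_cases i
    · have := hαlim m
      rw [← hwL] at this
      exact this
    · have hm : m ∈ T := by simpa using him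
      have := (hp m hm).1
      rw [← hlL] at this
      exact this
    · have hm : m ∈ T := by simpa using him
      have := (hp m hm).2
      rw [← hsL] at this
      exact this
  have hreset : ∀ B, Tendsto (resetOutside T B) U (𝓝 (resetOutside T B θL)) := by
    intro B
    refine tendsto_vec_of_apply fun i => ?_
    by_cases hi : i.1 = 0 ∨ i.2 ∈ T
    · simp only [resetOutside, hi, if_true]
      exact hcoord i hi
    · simp only [resetOutside, hi, if_false]
      exact tendsto_const_nhds
  set fT : ℝ → ℝ := fun x => ∑ m ∈ T, weight θL m * component φ θL m x with hfT
  by_cases haff : affinity f (fun x => ENNReal.ofReal (fT x)) < 1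
  · right
    obtain ⟨ε₁, hε₁, hε₁lt⟩ := ENNReal.lt_iff_exists_add_pos_lt.1 haff
    -- The scale `B` of the components put in place of those that do not converge is so large that
    -- they hardly contribute to the affinity.
    obtain ⟨a, ha, haε⟩ := exists_affinity_const_le hfm hf1
      (ENNReal.coe_ne_zero.2 hε₁.ne')
    set B := C / a with hB
    have hB0 : 0 < B := by positivity
    have hBmem : resetOutside T B θL ∈ paramSpace M :=
      resetOutside_mem_paramSpace hB0 hw0 hsum fun m _ => hs0 m
    have hfTm : Measurable fT :=
      Finset.measurable_sum _ fun m _ => (measurable_component hφ θL m).const_mul _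
    have hsplit : ∀ θ : Vec M, ∀ x, mixDensity φ (resetOutside T B θ) x =
        ∑ m ∈ T, weight θ m * component φ θ m x +
          ∑ m ∈ Tᶜ, weight θ m * component φ (resetOutside T B θ) m x := by
      intro θ x
      rw [mixDensity_eq_sum_component, ← Finset.sum_add_sum_compl T]
      simp only [weight_resetOutside]
      congr 1
      exact Finset.sum_congr rfl fun m hm => by rw [component_resetOutside_of_mem _ _ hm]
    have hBlt : affinity f (fun x => ENNReal.ofReal (mixDensity φ (resetOutside T B θL) x)) < 1 := by
      refine lt_of_le_of_lt ?_ hε₁lt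
      calc affinity f (fun x => ENNReal.ofReal (mixDensity φ (resetOutside T B θL) x))
          ≤ affinity f ((fun x => ENNReal.ofReal (fT x)) + fun _ => ENNReal.ofReal a) := by
            refine affinity_mono fun x => ?_
            rw [Pi.add_apply, hsplit]
            refine ENNReal.ofReal_add_le.trans ?_
            gcongr
            calc ∑ m ∈ Tᶜ, weight θL m * component φ (resetOutside T B θL) m x
                ≤ ∑ m ∈ Tᶜ, weight θL m * a := by
                  refine Finset.sum_le_sum fun m hm => mul_le_mul_of_nonneg_left ?_ (hw0 m)
                  refine (component_le_div_scale henv hC.le hβ0.le (hBmem.2.2 m) x).trans ?_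
                  rw [scale_resetOutside_of_notMem _ _ (Finset.mem_compl.1 hm), hB]
                  exact (by field_simp : C / (C / a) = a).le
              _ ≤ 1 * a := by
                  rw [← Finset.sum_mul, ← hsum]
                  gcongr
                  · exact fun m _ _ => hw0 m
                  · exact Finset.subset_univ _
              _ = a := one_mul a
        _ ≤ _ := affinity_add_le hfm (by fun_prop)
        _ ≤ _ := by gcongr
    obtain ⟨ρ, hρ, hρm, hρlt⟩ := exists_affinity_supDensity_lt hfm hft hf1 henv hC.le hβ0.le hmeas
      hcont hBmem hBlt
    obtain ⟨ε₂, hε₂, hε₂lt⟩ := ENNReal.lt_iff_exists_add_pos_lt.1 hρlt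
    have hE' : ∀ m, ∃ e : ℝ → ENNReal, Measurable e ∧ (m ∈ E →
        affinity f e ≤ (ε₂ : ENNReal) / M ∧
        ∀ᶠ θ in (U : Filter (Vec M)), ∀ x, ENNReal.ofReal (component φ θ m x) ≤ e x) := by
      intro m
      by_cases hm : m ∈ E
      · obtain ⟨-, hmT, hmA⟩ := Finset.mem_filter.1 hm
        rcases htri m with h | h | h
        · exact (hmT (Finset.mem_filter.2 ⟨Finset.mem_univ _, h⟩)).elim
        · exact absurd (Finset.mem_filter.2 ⟨Finset.mem_univ _, hmT, h⟩) hmA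
        · obtain ⟨e, h1, h2, h3⟩ := h ((ε₂ : ENNReal) / M)
            (ENNReal.div_ne_zero.2 ⟨ENNReal.coe_ne_zero.2 hε₂.ne', ENNReal.natCast_ne_top M⟩)
          exact ⟨e, h1, fun _ => ⟨h2, h3⟩⟩
      · exact ⟨0, measurable_const, fun h => absurd h hm⟩
    choose e hem heE using hE'
    obtain ⟨g, hg, hgle, hgae⟩ := exists_measurable_ge_ae_eq
      (u := supDensity φ (resetOutside T B θL) ρ + ∑ m ∈ E, e m)
      (hρm.add (Finset.aemeasurable_sum _ fun m _ => (hem m).aemeasurable))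
    refine ⟨g, hg, ?_, A, ?_, ?_⟩
    · rw [affinity_congr_ae hgae]
      refine lt_of_le_of_lt ((affinity_add_le hfm hρm).trans ?_) hε₂lt
      gcongr
      calc affinity f (∑ m ∈ E, e m) ≤ ∑ m ∈ E, affinity f (e m) :=
            affinity_sum_le hfm _ _ fun m _ => (hem m).aemeasurable
        _ ≤ ∑ _m : Fin M, (ε₂ : ENNReal) / M :=
            (Finset.sum_le_sum fun m hm => (heE m hm).1).trans
              (Finset.sum_le_sum_of_subset (Finset.subset_univ E))
        _ ≤ ε₂ := by
            rw [Finset.sum_const, nsmul_eq_mul, Finset.card_univ, Fintype.card_fin]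
            exact ENNReal.mul_div_le
    · have hEall : ∀ᶠ θ in (U : Filter (Vec M)), ∀ m ∈ E, ∀ x,
          ENNReal.ofReal (component φ θ m x) ≤ e m x :=
        (Finset.eventually_all E).2 fun m hm => (heE m hm).2
      filter_upwards [hU, hEall, (hreset B).eventually (Metric.closedBall_mem_nhds _ hρ)]
        with θ hθ hθE hθρ x
      have hmem : resetOutside T B θ ∈ paramSpace M :=
        resetOutside_mem_paramSpace hB0 hθ.1 hθ.2.1 fun m _ => hθ.2.2 m
      have hcl : ∀ m x, ENNReal.ofReal (weight θ m * component φ θ m x) ≤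
          ENNReal.ofReal (component φ θ m x) := fun m x =>
        ENNReal.ofReal_le_ofReal (weight_mul_component_le hφ hθ m x)
      have hTsum : ENNReal.ofReal (∑ m ∈ T, weight θ m * component φ θ m x) ≤
          supDensity φ (resetOutside T B θL) ρ x := by
        refine le_trans (ENNReal.ofReal_le_ofReal ?_)
          (le_iSup₂_of_le (resetOutside T B θ) ⟨hmem, hθρ⟩ le_rfl)
        rw [hsplit]
        refine le_add_of_nonneg_right (Finset.sum_nonneg fun m _ => ?_)
        exact mul_nonneg (hθ.1 m) (component_nonneg hφ (hmem.2.2 m) x)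
      have hcompl : Tᶜ = E ∪ A := by
        ext m
        simp only [hE, hA, Finset.mem_compl, Finset.mem_union, Finset.mem_filter, Finset.mem_univ,
          true_and]
        tauto
      calc ENNReal.ofReal (mixDensity φ θ x)
          ≤ ENNReal.ofReal (∑ m ∈ T, weight θ m * component φ θ m x) +
              ENNReal.ofReal (∑ m ∈ Tᶜ, weight θ m * component φ θ m x) := by
            rw [mixDensity_eq_sum_component, ← Finset.sum_add_sum_compl T]
            exact ENNReal.ofReal_add_le
        _ ≤ supDensity φ (resetOutside T B θL) ρ x + (∑ m ∈ E, e m x +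
              ∑ m ∈ A, ENNReal.ofReal (component φ θ m x)) := by
            gcongr
            rw [ENNReal.ofReal_sum_of_nonneg fun m _ =>
              mul_nonneg (hθ.1 m) (component_nonneg hφ (hθ.2.2 m) x), hcompl]
            have hdisj : Disjoint E A := Finset.disjoint_left.2 fun m hm =>
              (Finset.mem_filter.1 hm).2.2
            rw [Finset.sum_union hdisj]
            gcongr with m hm m hm
            · exact (hcl m x).trans (hθE m hm x)
            · exact weight_mul_component_le hφ hθ m x
        _ ≤ _ := by
            rw [← add_assoc]
            gcongr
            simpa using hgle x
    · intro κ hκ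
      exact (Finset.eventually_all A).2 fun m hm => (Finset.mem_filter.1 hm).2.2 κ hκ
  · left
    have hint : Integrable fT :=
      integrable_finsetSum _ fun m _ => (integrable_component hφ (hs0 m)).const_mul _
    have hint₀ : Integrable (mixDensity φ θ₀) :=
      integrable_finsetSum _ fun m _ => (integrable_component hφ (hθ₀.2.2 m)).const_mul _
    have hfTint : ∫ x, fT x = ∑ m ∈ T, weight θL m := integral_sum_weight_mul_component hφ hs0 T
    have h₀int : ∫ x, mixDensity φ θ₀ x = 1 :=
      (integral_sum_weight_mul_component hφ hθ₀.2.2 Finset.univ).trans hθ₀.2.1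
    have hTle : ∑ m ∈ T, weight θL m ≤ 1 := by
      rw [← hsum]
      exact Finset.sum_le_sum_of_subset_of_nonneg (Finset.subset_univ T) fun m _ _ => hw0 m
    have heq : fT =ᵐ[volume] mixDensity φ θ₀ :=
      ae_eq_of_one_le_affinity hint hint₀
        (fun x => Finset.sum_nonneg fun m _ => mul_nonneg (hw0 m) (component_nonneg hφ (hs0 m) x))
        (mixDensity_nonneg hφ hθ₀) (hfTint.trans_le hTle) h₀int (not_lt.1 haff)
    have hTsum : ∑ m ∈ T, weight θL m = 1 := by rw [← hfTint, integral_congr_ae heq, h₀int]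
    have hzero : ∀ m, m ∉ T → weight θL m = 0 := by
      have hc : ∑ m ∈ Tᶜ, weight θL m = 0 := by
        have := Finset.sum_add_sum_compl T fun m => weight θL m
        linarith
      intro m hm
      exact (Finset.sum_eq_zero_iff_of_nonneg fun m _ => hw0 m).1 hc m (Finset.mem_compl.2 hm)
    have hmix : mixDensity φ θL = fT := by
      funext x
      rw [mixDensity_eq_sum_component, hfT]
      refine (Finset.sum_subset (Finset.subset_univ T) fun m _ hm => ?_).symm
      rw [hzero m hm, zero_mul]
    have hTuniv : T = Finset.univ := by
      by_contra hne
      refine hexact ⟨θL, hLmem, ?_, by rw [hmix]; exact heq.symm⟩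
      have hsub : {m | weight θL m ≠ 0} ⊆ (T : Set (Fin M)) := fun m hm => by
        by_contra h
        exact hm (hzero m h)
      have h1 : Set.ncard {m | weight θL m ≠ 0} ≤ T.card :=
        (Set.ncard_le_ncard hsub T.finite_toSet).trans (Set.ncard_coe_finset T).le
      have h2 : T.card < M := by
        simpa using Finset.card_lt_card (Finset.ssubset_univ_iff.2 hne)
      omega
    refine ⟨θL, ⟨hLmem, by rw [hmix]; exact heq⟩, ?_⟩
    exact tendsto_vec_of_apply (h := id) fun i => hcoord i (Or.inr (by rw [hTuniv]; simp))

end Dichotomy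

/-! ### Distance between sets of parameters -/

lemma setDist_nonneg {M : ℕ} (V W : Set (Vec M)) : 0 ≤ setDist V W :=
  Real.sInf_nonneg (by rintro _ ⟨a, -, b, -, rfl⟩; exact dist_nonneg)

lemma setDist_le_dist {M : ℕ} {V W : Set (Vec M)} {a b : Vec M} (ha : a ∈ V) (hb : b ∈ W) :
    setDist V W ≤ dist a b :=
  csInf_le ⟨0, by rintro _ ⟨a, -, b, -, rfl⟩; exact dist_nonneg⟩ ⟨a, ha, b, hb, rfl⟩

end LocScaleMixture

theorem theorem1 {M : ℕ} (φ : Fin M → ℝ → ℝ) (hφ : ∀ m, IsProbDensity (φ m))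
    (θ₀ : Vec M) (hθ₀ : θ₀ ∈ paramSpace M)
    (hmeas : SupDensityMeasurable φ) (hcont : AEContinuousInParam φ) (hlog : LogIntegrable φ θ₀)
    (htail : TailBound φ)
    (hexact : mixDensity φ θ₀ ∈ mixtureClass φ M \ mixtureClass φ (M - 1))
    (rbar : ℕ → ℝ → ℝ) (dt b₀ : ℝ) (hdt₀ : 0 ≤ dt) (hdt₁ : dt < 1) (hb₀ : 0 < b₀)
    (hbound : RewardBound M rbar dt) (hlower : RewardLowerBound φ θ₀ rbar)
    (hsmall : ScalesEquallySmall M rbar dt b₀)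
    {Ω : Type*} [MeasurableSpace Ω] (P : Measure Ω) [IsProbabilityMeasure P]
    (X : ℕ → Ω → ℝ) (hX : IsSample P X (mixDensity φ θ₀))
    (c : ℝ) (hc₀ : 0 < c) (hc₁ : c ≤ 1) (est : ℕ → Ω → Vec M)
    (hest : ∀ᵐ ω ∂P, ∀ᶠ n in atTop, IsPenalizedMLE φ rbar c n (fun i => X i ω) (est n ω)) :
    StronglyConsistent φ θ₀ P est := by
  classical
  -- The parameters at distance at least `ε` from `Θ₀` are covered by finitely many sets on which
  -- the penalized likelihood is eventually too small: otherwise some ultrafilter avoids them all.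
  set lose : Set (Vec M) → Prop := fun V => ∀ᵐ ω ∂P, ∀ᶠ n in atTop, ∀ θ ∈ paramSpace M, θ ∈ V →
    penLikelihood φ rbar n (fun i => X i ω) θ <
      c * penLikelihood φ rbar n (fun i => X i ω) θ₀ with hlose
  have hlose_empty : lose ∅ := ae_of_all _ fun ω => Eventually.of_forall fun n θ _ h => by simp at h
  have hlose_mono : ∀ V, lose V → ∀ W ⊆ V, lose W := fun V hV W hWV => by
    filter_upwards [hV] with ω hω
    filter_upwards [hω] with n hn θ hθ hθW
    exact hn θ hθ (hWV hθW)
  have hlose_union : ∀ V, lose V → ∀ W, lose W → lose (V ∪ W) := fun V hV W hW => by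
    filter_upwards [hV, hW] with ω h1 h2
    filter_upwards [h1, h2] with n h1 h2 θ hθ hθVW
    exact hθVW.elim (h1 θ hθ) (h2 θ hθ)
  have hfar : ∀ ε > 0, lose {θ | θ ∈ paramSpace M ∧ ∀ θ' ∈ sameDensity φ θ₀, ε ≤ dist θ θ'} := by
    intro ε hε
    set V : Set (Vec M) := {θ | θ ∈ paramSpace M ∧ ∀ θ' ∈ sameDensity φ θ₀, ε ≤ dist θ θ'} with hV
    by_contra hcon
    set 𝓕 := Filter.comk lose hlose_empty hlose_mono hlose_union with h𝓕
    have hne : NeBot (𝓕 ⊓ 𝓟 V) := by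
      refine ⟨fun hbot => hcon ?_⟩
      have := inf_principal_eq_bot.1 hbot
      rw [h𝓕, mem_comk, compl_compl] at this
      exact this
    set U := Ultrafilter.of (𝓕 ⊓ 𝓟 V)
    have hUle : (U : Filter (Vec M)) ≤ 𝓕 ⊓ 𝓟 V := Ultrafilter.of_le _
    have hUV : ∀ᶠ θ in (U : Filter (Vec M)), θ ∈ V := hUle (mem_inf_of_right (mem_principal_self V))
    have hUlose : ∀ W, lose W → W ∉ (U : Filter (Vec M)) := by
      intro W hW hWU
      have h1 : Wᶜ ∈ 𝓕 := by rw [h𝓕, mem_comk, compl_compl]; exact hW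
      have h2 := inter_mem hWU (hUle (mem_inf_of_left h1))
      rw [Set.inter_compl_self] at h2
      exact U.empty_notMem h2
    rcases ultrafilter_dichotomy hφ hθ₀ hmeas hcont htail hexact.2 U (hUV.mono fun θ h => h.1) with
      ⟨θ', hθ', hle⟩ | ⟨g, hg, hgaff, A, hdom, hsm⟩
    · have hball : ∀ᶠ θ in (U : Filter (Vec M)), dist θ θ' < ε := hle (Metric.ball_mem_nhds θ' hε)
      obtain ⟨θ, h1, h2⟩ := (hUV.and hball).exists
      exact absurd (h1.2 θ' hθ') (not_le.2 h2)
    · obtain ⟨κ, hκ, hae⟩ := exists_ae_eventually_penLikelihood_lt hφ hθ₀ htail rbar dt b₀ hdt₁ hb₀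
        hbound hlower hsmall P X hX hc₀ hg hgaff A
      refine hUlose {θ | (∀ x, ENNReal.ofReal (mixDensity φ θ x) ≤
        g x + ∑ m ∈ A, ENNReal.ofReal (component φ θ m x)) ∧ ∀ m ∈ A, scale θ m < κ} ?_
        (hdom.and (hsm κ hκ))
      filter_upwards [hae] with ω hω
      filter_upwards [hω] with n hn θ hθ hθW
      exact hn θ hθ hθW.1 hθW.2
  have hfar_all : ∀ᵐ ω ∂P, ∀ k : ℕ, ∀ᶠ n in atTop, ∀ θ ∈ paramSpace M,
      θ ∈ {θ | θ ∈ paramSpace M ∧ ∀ θ' ∈ sameDensity φ θ₀, 1 / ((k : ℝ) + 1) ≤ dist θ θ'} →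
      penLikelihood φ rbar n (fun i => X i ω) θ <
        c * penLikelihood φ rbar n (fun i => X i ω) θ₀ :=
    ae_all_iff.2 fun k => hfar (1 / ((k : ℝ) + 1)) Nat.one_div_pos_of_nat
  filter_upwards [hest, hfar_all] with ω hω hk
  refine tendsto_order.2 ⟨fun a ha => Eventually.of_forall fun n => ha.trans_le (setDist_nonneg _ _),
    fun a ha => ?_⟩
  obtain ⟨k, hka⟩ := exists_nat_one_div_lt ha
  filter_upwards [hω, hk k] with n hn hnk
  have hnot : ¬ ∀ θ' ∈ sameDensity φ θ₀, 1 / ((k : ℝ) + 1) ≤ dist (est n ω) θ' := fun hall =>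
    absurd (hn.2 θ₀ hθ₀) (not_le.2 (hnk _ hn.1 ⟨hn.1, hall⟩))
  push Not at hnot
  obtain ⟨θ', hθ', hd⟩ := hnot
  have hself : est n ω ∈ sameDensity φ (est n ω) := ⟨hn.1, EventuallyEq.rfl⟩
  exact (setDist_le_dist hself hθ').trans_lt (hd.trans hka)
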